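/- Let $F$ be a field of characteristic $2$. A totally singular quadratic form over $F$ is a quadratic form $\varphi:V\to F$ on a finite-dimensional $F$-vector space such that $\varphi(v+w)=\varphi(v)+\varphi(w)$ for all $v,w\in V$; $\dim\varphi=\dim V$. Write $\varphi\simeq\psi$ for isometry, $\varphi\subseteq\psi$ if there is an injective linear isometry from $\varphi$ to $\psi$, and call $\varphi,\psi$ similar if $\varphi\simeq c\psi$ for some $c\in F^*$. The defect $\mathfrak{i}(\varphi)$ is the integer $k$ such that $\varphi\simeq\varphi_0\perp k\times\langle 0\rangle$ with $\varphi_0$ anisotropic. For a field extension $E/F$, $\varphi_E$ is the totally singular form on $E\otimes_F V$ with $\varphi_E(e\otimes v)=e^2\varphi(v)$. The forms $\varphi,\psi$ are weakly Vishik equivalent if $\dim\varphi=\dim\psi$ and $\mathfrak{i}(\varphi_{F(\sqrt a)})=\mathfrak{i}(\psi_{F(\sqrt a)})$ for all $a\in F$. A quasi-Pfister form is a form isometric to $\langle 1,a_1\rangle\otimes\dots\otimes\langle 1,a_n\rangle$ for some $n\ge 0$ and $a_i\in F$ (to $\langle 1\rangle$ if $n=0$). A form $\sigma$ is a quasi-Pfister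 neighbor of codimension one if $c\sigma\subseteq\tau$ for some $c\in F^*$ and some quasi-Pfister form $\tau$ with $\dim\sigma>\frac12\dim\tau$ and $\dim\tau-\dim\sigma=1$. A form $\sigma$ is minimal if it is anisotropic, of positive dimension, and $[N_F(\sigma):F^2]=2^{\dim\sigma-1}$, where $N_F(\sigma)=F^2\bigl(\tfrac xy \,\big|\, x,y \text{ nonzero values of }\sigma\bigr)$. **Theorem.** Let $\varphi,\psi$ be weakly Vishik equivalent totally singular quadratic forms over $F$. Assume that $\varphi$ is a special quasi-Pfister neighbor given by a triple $(\pi,b,\sigma)$, i.e. $\varphi$ is similar to $\pi\perp b\sigma$, where $\pi$ is a quasi-Pfister form over $F$, $b\in F^*$ and $\sigma\subseteq\pi$; and assume that $c\pi\subseteq\psi$ for some $c\in F^*$. If $\sigma$ is a quasi-Pfister form, a quasi-Pfister neighbor of codimension one, or a minimal form, then $\varphi$ and $\psi$ are similar. -/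

import Mathlib

open scoped TensorProduct IntermediateField

noncomputable section

namespace TSForm

universe u v w

variable {F : Type u} [Field F] {V : Type v} [AddCommGroup V] [Module F V]
  {W : Type w} [AddCommGroup W] [Module F W]

/-- A quadratic form is totally singular if it is additive. -/
def IsTotallySingular (φ : QuadraticForm F V) : Prop :=
  ∀ x y : V, φ (x + y) = φ x + φ y

/-- `φ ⊆ ψ`: there is an injective linear isometry from `φ` to `ψ`. -/
def IsSubform (φ : QuadraticForm F V) (ψ : QuadraticForm F W) : Prop :=
  ∃ f : V →ₗ[F] W, Function.Injective f ∧ ∀ x : V, ψ (f x) = φ x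

/-- Similarity: `φ ≃ c ψ` for some nonzero scalar `c`. -/
def IsSimilar (φ : QuadraticForm F V) (ψ : QuadraticForm F W) : Prop :=
  ∃ c : F, c ≠ 0 ∧ QuadraticMap.Equivalent φ (c • ψ)

/-- The quasi-Pfister form `⟪a₁, …, aₙ⟫ = ⟨1, a₁⟩ ⊗ ⋯ ⊗ ⟨1, aₙ⟩`, i.e. the diagonal form whose
coefficients are the `2 ^ n` products `∏ i ∈ S, aᵢ`, for `S ⊆ {1, …, n}`. It is `⟨1⟩` for
`n = 0`. -/
def pfister {n : ℕ} (a : Fin n → F) : QuadraticForm F (Finset (Fin n) → F) :=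
  QuadraticMap.weightedSumSquares F (fun S : Finset (Fin n) => ∏ i ∈ S, a i)

/-- `φ` is (isometric to) a quasi-Pfister form. -/
def IsQuasiPfister (φ : QuadraticForm F V) : Prop :=
  ∃ (n : ℕ) (a : Fin n → F), QuadraticMap.Equivalent φ (pfister a)

/-- `φ` is a quasi-Pfister neighbor of codimension `k`: there is a quasi-Pfister form `π`, of
dimension `2 ^ n`, such that `c φ ⊆ π` for some nonzero `c`, `dim φ > dim π / 2`, and
`dim π - dim φ = k`. -/
def IsQuasiPfisterNeighborOfCodim (φ : QuadraticForm F V) (k : ℕ) : Prop :=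
  ∃ (n : ℕ) (a : Fin n → F) (c : F), c ≠ 0 ∧ IsSubform (c • φ) (pfister a) ∧
    2 ^ n < 2 * Module.finrank F V ∧ Module.finrank F V + k = 2 ^ n

/-- `φ` is a special quasi-Pfister neighbor given by the triple `(π, b, σ)`. -/
structure IsSpecialQuasiPfisterNeighbor {P S : Type*} [AddCommGroup P] [Module F P]
    [AddCommGroup S] [Module F S] (φ : QuadraticForm F V)
    (π : QuadraticForm F P) (b : F) (σ : QuadraticForm F S) : Prop where
  isQuasiPfister : IsQuasiPfister π
  ne_zero : b ≠ 0
  isSubform : IsSubform σ π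
  isSimilar : IsSimilar φ (QuadraticMap.prod π (b • σ))

section NormField

variable [CharP F 2]

/-- The norm field `F²(x / y | x, y nonzero values of φ)`, as an intermediate field of `F / F²`. -/
def normField (φ : QuadraticForm F V) : IntermediateField (frobenius F 2).fieldRange F :=
  IntermediateField.adjoin (frobenius F 2).fieldRange
    {z : F | ∃ x y : V, φ x ≠ 0 ∧ φ y ≠ 0 ∧ z = φ x / φ y}

/-- The norm degree `[N_F(φ) : F²]`. -/
def normDegree (φ : QuadraticForm F V) : ℕ :=
  Module.finrank (frobenius F 2).fieldRange (normField φ)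

/-- `φ` is minimal: it is anisotropic (of positive dimension) and its norm degree is
`2 ^ (dim φ - 1)`. -/
def IsMinimal (φ : QuadraticForm F V) : Prop :=
  φ.Anisotropic ∧ 0 < Module.finrank F V ∧ normDegree φ = 2 ^ (Module.finrank F V - 1)

end NormField

section BaseChange

variable [CharP F 2]

/-- The additive map `E ⊗ V → E` with `e ⊗ v ↦ e² φ(v)`, for `φ` totally singular. -/
def baseChangeAddHom (E : Type*) [Field E] [Algebra F E] (φ : QuadraticForm F V)
    (hφ : IsTotallySingular φ) : E ⊗[F] V →+ E :=
  TensorProduct.liftAddHom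
    (AddMonoidHom.mk' (fun e : E =>
        AddMonoidHom.mk' (fun x : V => e ^ 2 * algebraMap F E (φ x))
          (fun x y => by rw [hφ x y, map_add, mul_add]))
      (fun e e' => by
        have : CharP E 2 := charP_of_injective_algebraMap (algebraMap F E).injective 2
        ext x
        simp [CharTwo.add_sq, add_mul]))
    (fun r e x => by
      simp [QuadraticMap.map_smul, Algebra.smul_def]
      ring)

@[simp]
theorem baseChangeAddHom_tmul (E : Type*) [Field E] [Algebra F E] (φ : QuadraticForm F V)
    (hφ : IsTotallySingular φ) (e : E) (x : V) :
    baseChangeAddHom E φ hφ (e ⊗ₜ[F] x) = e ^ 2 * algebraMap F E (φ x) := rfl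

/-- The totally singular form `φ_E` on `E ⊗ V`, determined by `φ_E(e ⊗ v) = e² φ(v)`. -/
def baseChange (E : Type*) [Field E] [Algebra F E] (φ : QuadraticForm F V)
    (hφ : IsTotallySingular φ) : QuadraticForm E (E ⊗[F] V) where
  toFun := baseChangeAddHom E φ hφ
  toFun_smul c x := by
    induction x with
    | zero => simp
    | tmul e x =>
      simp only [TensorProduct.smul_tmul', baseChangeAddHom_tmul, smul_eq_mul]
      ring
    | add x y hx hy => rw [smul_add, map_add, map_add, hx, hy, smul_add]
  exists_companion' := ⟨0, fun x y => by simp⟩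

theorem baseChange_tmul (E : Type*) [Field E] [Algebra F E] (φ : QuadraticForm F V)
    (hφ : IsTotallySingular φ) (e : E) (x : V) :
    baseChange E φ hφ (e ⊗ₜ[F] x) = e ^ 2 * algebraMap F E (φ x) := rfl

theorem baseChange_isTotallySingular (E : Type*) [Field E] [Algebra F E]
    (φ : QuadraticForm F V) (hφ : IsTotallySingular φ) :
    IsTotallySingular (baseChange E φ hφ) :=
  fun x y => map_add (baseChangeAddHom E φ hφ) x y

end BaseChange

/-- The subspace of isotropic vectors (together with `0`) of a totally singular form. -/
def zeroSpace (φ : QuadraticForm F V) (hφ : IsTotallySingular φ) : Submodule F V where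
  carrier := {x | φ x = 0}
  zero_mem' := QuadraticMap.map_zero φ
  add_mem' {x y} hx hy := by
    simp only [Set.mem_ofPred_eq] at hx hy ⊢
    rw [hφ, hx, hy, add_zero]
  smul_mem' c x hx := by
    simp only [Set.mem_ofPred_eq] at hx ⊢
    rw [QuadraticMap.map_smul, hx, smul_zero]

/-- The defect of a totally singular form: the number `k` such that `φ` is isometric to
`σ ⊥ k × ⟨0⟩` with `σ` anisotropic (see `defect_eq_of_equivalent`), i.e. the dimension of the
space of its isotropic vectors. -/
def defect (φ : QuadraticForm F V) (hφ : IsTotallySingular φ) : ℕ :=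
  Module.finrank F (zeroSpace φ hφ)

theorem defect_eq_of_equivalent (φ : QuadraticForm F V) (hφ : IsTotallySingular φ)
    (σ : QuadraticForm F W) (hσ : σ.Anisotropic) (k : ℕ)
    (h : QuadraticMap.Equivalent φ
      (QuadraticMap.prod σ (QuadraticMap.weightedSumSquares F (fun _ : Fin k => (0 : F))))) :
    defect φ hφ = k := by
  obtain ⟨e⟩ := h
  have key : ∀ x : V, φ x = σ (e x).1 := by
    intro x
    rw [← e.map_app x, QuadraticMap.prod_apply]
    simp [QuadraticMap.weightedSumSquares_apply]
  let g : (Fin k → F) →ₗ[F] V := (e.toLinearEquiv.symm : _ →ₗ[F] V) ∘ₗ LinearMap.inr F W (Fin k → F)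
  have hg : Function.Injective g :=
    e.toLinearEquiv.symm.injective.comp LinearMap.inr_injective
  have hr : zeroSpace φ hφ = LinearMap.range g := by
    ext x
    constructor
    · intro hx
      have h1 : (e x).1 = 0 := hσ _ ((key x).symm.trans hx)
      refine ⟨(e x).2, ?_⟩
      apply e.toLinearEquiv.injective
      change e.toLinearEquiv (e.toLinearEquiv.symm (0, (e x).2)) = e x
      rw [LinearEquiv.apply_symm_apply]
      exact Prod.ext h1.symm rfl
    · rintro ⟨y, rfl⟩
      change φ _ = 0
      rw [key]
      change σ (e.toLinearEquiv (e.toLinearEquiv.symm (0, y))).1 = 0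
      rw [LinearEquiv.apply_symm_apply]
      simp
  rw [defect, hr, LinearMap.finrank_range_of_inj hg]
  simp

/-- Weak Vishik equivalence: `φ` and `ψ` have the same dimension and, for every `a` in `F`, the
same defect over `F(√a)`. Here `α` is the square root of `a` in an algebraic closure of `F`. -/
def WeaklyVishikEquivalent [CharP F 2] (φ : QuadraticForm F V) (hφ : IsTotallySingular φ)
    (ψ : QuadraticForm F W) (hψ : IsTotallySingular ψ) : Prop :=
  Module.finrank F V = Module.finrank F W ∧
    ∀ (a : F) (α : AlgebraicClosure F), α ^ 2 = algebraMap F (AlgebraicClosure F) a →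
      defect (baseChange F⟮α⟯ φ hφ) (baseChange_isTotallySingular F⟮α⟯ φ hφ) =
        defect (baseChange F⟮α⟯ ψ hψ) (baseChange_isTotallySingular F⟮α⟯ ψ hψ)

end TSForm

end

/-!
Put `K = F²`. A totally singular form is additive and Frobenius-semilinear, so its values form a
`K`-subspace of `F` (`valueSpace`), whose dimension is the dimension of the form minus its defect,
and the form is determined up to isometry by its dimension and this subspace
(`equivalent_of_valueSpace_eq`). For `a` not a square, the defect over `F(√a)` is half of the defect
of `φ ⊥ aφ`. Hence weak Vishik equivalence of forms with values `U` and `U'` says that `U + aU` and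
`U' + aU'` have the same dimension for all `a` (`WeaklyVishikEquivalent.sameSpans`), and the theorem
becomes a statement on subspaces: under this condition, `U'` is a multiple of `U`. The subspaces are
treated over any subfield `K` which contains all squares of `F`; this is the hypothesis `hsq`.

The values of a quasi-Pfister form are a subfield of `F` (`exists_valueSpace_pfister_eq`). After
scaling, `U = L + bS` with a field `L`, a subspace `S ⊆ L` (the values of `σ`), and `L ⊆ U'`. If
`b ∈ L`, then `U = L = U'`. Otherwise `U + bU = L(b)`, so that `U' ⊆ L + bL`, and the modular law
gives `U' = L + bS'` with `S' ⊆ L`, where `S` and `S'` satisfy the same condition as `U` and `U'`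
(`exists_eq_sup_smul`). It remains to show that `S'` is a multiple of `S`.

* If `S` has codimension at most one in a subfield `M` (up to a factor), then for `a ∈ M` the
  operators `x ↦ ax` from `S'` to `F / S'` have rank at most one. A linear space of such operators
  has a common image line or a common kernel of codimension one
  (`common_line_or_common_kernel`); in either case `S'` lies in a line over `M`. Any two hyperplanes
  of `M` are multiples of each other (`SameSpans.exists_eq_smul_of_le_field`).
* If `σ` is minimal, then `S'` is minimal too, because `S` and `S'` have the same ratios. Minimality
  makes `x ∧ y ↦ xy` injective from the bivectors of `S'` to `F / K`
  (`hasIndependentProducts_of_degree`). Assume `1 ∈ S`. The elements of `S` are products of two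
  elements of `S'`, that is, planes in `S'`. As `S` is closed under addition, any two of these
  planes meet, so either they have a common line, which means that `S'` is a multiple of `S`, or
  they all lie in one three-dimensional space, and `S` lies in a field of degree four
  (`SameSpans.exists_eq_smul_of_hasIndependentProducts`). In the latter case the first item applies.
-/

open Module
open scoped Pointwise

namespace TSForm

/-! ### Spans of subspaces and linear spaces of operators of rank one -/

section Subspaces

variable {K F : Type*} [Field K] [Field F] [Algebra K F]

theorem mem_smul_iff_inv_mul_mem {U : Submodule K F} {a x : F} (ha : a ≠ 0) :
    x ∈ a • U ↔ a⁻¹ * x ∈ U := by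
  rw [Submodule.mem_smul_pointwise_iff_exists]
  constructor
  · rintro ⟨y, hy, rfl⟩
    simpa [ha] using hy
  · intro h
    exact ⟨_, h, by simp [ha]⟩

theorem mul_mem_smul {U : Submodule K F} {a x : F} (hx : x ∈ U) : a * x ∈ a • U :=
  Submodule.smul_mem_pointwise_smul x a U hx

theorem zero_smul_submodule (U : Submodule K F) : (0 : F) • U = ⊥ := by
  ext x
  rw [Submodule.mem_smul_pointwise_iff_exists, Submodule.mem_bot]
  constructor
  · rintro ⟨y, -, rfl⟩
    simp
  · rintro rfl
    exact ⟨0, U.zero_mem, by simp⟩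

theorem smul_le_smul_submodule {U U' : Submodule K F} (a : F) (h : U ≤ U') : a • U ≤ a • U' :=
  Submodule.map_mono h

instance finiteDimensional_smul (U : Submodule K F) [FiniteDimensional K U] (a : F) :
    FiniteDimensional K (a • U : Submodule K F) :=
  inferInstanceAs (FiniteDimensional K (U.map (DistribSMul.toLinearMap K F a)))

theorem finrank_smul_submodule (U : Submodule K F) {a : F} (ha : a ≠ 0) :
    finrank K (a • U : Submodule K F) = finrank K U := by
  have : Function.Injective (DistribSMul.toLinearMap K F a) := fun x y h =>
    mul_left_cancel₀ ha h
  exact (LinearEquiv.finrank_eq (Submodule.equivMapOfInjective _ this U)).symm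

/-- The linear-algebraic form of weak Vishik equivalence for subspaces of `F`. When the square of
every element of `F` lies in `K`, the space `U + aU` is the `K(a)`-span of `U`. -/
def SameSpans (U U' : Submodule K F) : Prop :=
  ∀ a : F, finrank K (U ⊔ a • U : Submodule K F) = finrank K (U' ⊔ a • U' : Submodule K F)

theorem SameSpans.finrank_eq {U U' : Submodule K F} (h : SameSpans U U') :
    finrank K U = finrank K U' := by
  have := h 0
  rwa [zero_smul_submodule, zero_smul_submodule, sup_bot_eq, sup_bot_eq] at this

theorem SameSpans.symm {U U' : Submodule K F} (h : SameSpans U U') : SameSpans U' U :=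
  fun a => (h a).symm

theorem SameSpans.trans {U U' U'' : Submodule K F} (h : SameSpans U U') (h' : SameSpans U' U'') :
    SameSpans U U'' :=
  fun a => (h a).trans (h' a)

theorem sameSpans_smul (U : Submodule K F) {c : F} (hc : c ≠ 0) : SameSpans (c • U) U := by
  intro a
  rw [smul_comm a c U, ← Submodule.smul_sup', finrank_smul_submodule _ hc]

theorem SameSpans.finrank_inf_eq {U U' : Submodule K F} [FiniteDimensional K U]
    [FiniteDimensional K U'] (h : SameSpans U U') {a : F} (ha : a ≠ 0) :
    finrank K (U ⊓ a • U : Submodule K F) = finrank K (U' ⊓ a • U' : Submodule K F) := by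
  have h1 := Submodule.finrank_sup_add_finrank_inf_eq U (a • U)
  have h2 := Submodule.finrank_sup_add_finrank_inf_eq U' (a • U')
  rw [finrank_smul_submodule _ ha] at h1 h2
  have := h a
  have := h.finrank_eq
  omega

theorem mem_of_sq_mul_mem (hsq : ∀ x : F, ∃ k : K, algebraMap K F k = x ^ 2) {U : Submodule K F}
    (a : F) {x : F} (hx : x ∈ U) : a ^ 2 * x ∈ U := by
  obtain ⟨k, hk⟩ := hsq a
  rw [← hk, ← Algebra.smul_def]
  exact U.smul_mem k hx

/-- Cancellation of the subfield `L`: if `U = L + bS` with `S ⊆ L` and `b ∉ L`, then any `U' ⊇ L`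
with the same spans as `U` is `L + bS'` for some `S' ⊆ L` with the same spans as `S`. The span by
`b` forces `U' ⊆ L(b) = L + bL`. -/
theorem exists_eq_sup_smul (hsq : ∀ x : F, ∃ k : K, algebraMap K F k = x ^ 2)
    (L : IntermediateField K F) [FiniteDimensional K L] {b : F} (hb : b ∉ L)
    {S U' : Submodule K F} (hS : S ≤ Subalgebra.toSubmodule L.toSubalgebra)
    [FiniteDimensional K U'] (hL : Subalgebra.toSubmodule L.toSubalgebra ≤ U')
    (h : SameSpans (Subalgebra.toSubmodule L.toSubalgebra ⊔ b • S) U') :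
    ∃ S' ≤ Subalgebra.toSubmodule L.toSubalgebra,
      U' = Subalgebra.toSubmodule L.toSubalgebra ⊔ b • S' ∧ SameSpans S S' := by
  have hb0 : b ≠ 0 := fun h => hb (h ▸ L.zero_mem)
  set M : Submodule K F := Subalgebra.toSubmodule L.toSubalgebra with hM
  have memM : ∀ x, x ∈ M ↔ x ∈ L := fun x => Iff.rfl
  have : FiniteDimensional K M := ‹FiniteDimensional K L›
  have hMS : ∀ {a : F}, a ∈ L → a • M ≤ M := by
    intro a ha x hx
    obtain ⟨y, hy, rfl⟩ := (Submodule.mem_smul_pointwise_iff_exists _ _ _).1 hx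
    exact L.mul_mem ha hy
  have hspan : (M ⊔ b • S) ⊔ b • (M ⊔ b • S) = M ⊔ b • M := by
    apply le_antisymm
    · refine sup_le (sup_le le_sup_left ?_) ?_
      · exact (smul_le_smul_submodule b hS).trans le_sup_right
      · rw [Submodule.smul_sup']
        refine sup_le le_sup_right ?_
        refine le_trans ?_ le_sup_left
        intro x hx
        obtain ⟨y, hy, rfl⟩ := (Submodule.mem_smul_pointwise_iff_exists _ _ _).1 hx
        obtain ⟨z, hz, rfl⟩ := (Submodule.mem_smul_pointwise_iff_exists _ _ _).1 hy
        have := mem_of_sq_mul_mem hsq b (hS hz)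
        simpa [smul_eq_mul, sq, mul_assoc] using this
    · exact sup_le_sup le_sup_left (smul_le_smul_submodule b le_sup_left)
  have hle : M ⊔ b • M ≤ U' ⊔ b • U' := sup_le_sup hL (smul_le_smul_submodule b hL)
  have heq : M ⊔ b • M = U' ⊔ b • U' := by
    apply Submodule.eq_of_le_of_finrank_eq hle
    rw [← h b, hspan]
  have hU' : U' ≤ M ⊔ b • M := heq ▸ le_sup_left
  -- if `b * x` lies in `L` with `x` in `L`, then `x = 0`
  have hdisj : ∀ {x}, x ∈ L → b * x ∈ L → x = 0 := by
    intro x hx hbx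
    by_contra hx0
    apply hb
    have := L.div_mem hbx hx
    rwa [mul_div_cancel_right₀ _ hx0] at this
  have hfin : ∀ T : Submodule K F, T ≤ M →
      finrank K (M ⊔ b • T : Submodule K F) = finrank K M + finrank K T := by
    intro T hT
    have : FiniteDimensional K T := Submodule.finiteDimensional_of_le hT
    have h1 := Submodule.finrank_sup_add_finrank_inf_eq M (b • T)
    have h2 : M ⊓ b • T = ⊥ := by
      rw [Submodule.eq_bot_iff]
      rintro x ⟨hx, hx'⟩
      obtain ⟨y, hy, rfl⟩ := (Submodule.mem_smul_pointwise_iff_exists _ _ _).1 hx'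
      simp [hdisj (hT hy) hx]
    rw [h2, finrank_bot, finrank_smul_submodule _ hb0] at h1
    omega
  let S' : Submodule K F := M ⊓ U'.comap (DistribSMul.toLinearMap K F b)
  have memS' : ∀ x, x ∈ S' ↔ x ∈ L ∧ b * x ∈ U' := fun x => Iff.rfl
  have hS'M : S' ≤ M := inf_le_left
  have hU'S' : U' = M ⊔ b • S' := by
    apply le_antisymm
    · intro x hx
      obtain ⟨l, hl, y, hy, rfl⟩ := Submodule.mem_sup.1 (hU' hx)
      obtain ⟨l', hl', rfl⟩ := (Submodule.mem_smul_pointwise_iff_exists _ _ _).1 hy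
      refine Submodule.add_mem_sup hl (mul_mem_smul ((memS' _).2 ⟨hl', ?_⟩))
      have := U'.sub_mem hx (hL hl)
      simpa using this
    · refine sup_le hL ?_
      intro x hx
      obtain ⟨y, hy, rfl⟩ := (Submodule.mem_smul_pointwise_iff_exists _ _ _).1 hx
      exact ((memS' _).1 hy).2
  refine ⟨S', hS'M, hU'S', ?_⟩
  have : FiniteDimensional K S := Submodule.finiteDimensional_of_le hS
  have : FiniteDimensional K S' := Submodule.finiteDimensional_of_le hS'M
  have hSS' : finrank K S = finrank K S' := by
    have h1 := h.finrank_eq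
    rw [hU'S', hfin _ hS, hfin _ hS'M] at h1
    omega
  intro a
  by_cases ha : a ∈ L
  · have key : ∀ T ≤ M, finrank K ((M ⊔ b • T) ⊔ a • (M ⊔ b • T) : Submodule K F) =
        finrank K M + finrank K (T ⊔ a • T : Submodule K F) := by
      intro T hT
      rw [← hfin _ (sup_le hT ((smul_le_smul_submodule a hT).trans (hMS ha))),
        Submodule.smul_sup', Submodule.smul_sup', smul_comm a b T, sup_sup_sup_comm,
        sup_of_le_left (hMS ha)]
    have h1 := h a
    rw [hU'S', key _ hS, key _ hS'M] at h1
    omega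
  · -- outside of `L` the sum `T + aT` is direct
    have key : ∀ T ≤ M, finrank K (T ⊔ a • T : Submodule K F) = finrank K T + finrank K T := by
      intro T hT
      have ha0 : a ≠ 0 := fun h => ha (h ▸ L.zero_mem)
      have : FiniteDimensional K T := Submodule.finiteDimensional_of_le hT
      have h1 := Submodule.finrank_sup_add_finrank_inf_eq T (a • T)
      have h2 : T ⊓ a • T = ⊥ := by
        rw [Submodule.eq_bot_iff]
        rintro x ⟨hx, hx'⟩
        obtain ⟨y, hy, rfl⟩ := (Submodule.mem_smul_pointwise_iff_exists _ _ _).1 hx'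
        by_contra h0
        have hy0 : y ≠ 0 := by rintro rfl; simp at h0
        apply ha
        have := L.div_mem (hT hx) (hT hy)
        rwa [smul_eq_mul, mul_div_cancel_right₀ _ hy0] at this
      rw [h2, finrank_bot, finrank_smul_submodule _ ha0] at h1
      omega
    rw [key _ hS, key _ hS'M, hSS']

/-- A linear space of operators of rank at most one has a common image line, or its operators all
vanish on the kernel of one functional. -/
theorem common_line_or_common_kernel {M X Y : Type*} [AddCommGroup M] [Module K M]
    [AddCommGroup X] [Module K X] [AddCommGroup Y] [Module K Y] (B : M →ₗ[K] X →ₗ[K] Y)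
    (h : ∀ a, ∃ v, ∀ x, B a x ∈ K ∙ v) :
    (∃ v, ∀ a x, B a x ∈ K ∙ v) ∨ ∃ f : X →ₗ[K] K, ∀ x, f x = 0 → ∀ a, B a x = 0 := by
  -- two values of one operator are never independent
  have dep : ∀ a x y, B a x ≠ 0 → B a y ∈ K ∙ B a x := by
    intro a x y hx
    obtain ⟨v, hv⟩ := h a
    obtain ⟨k, hk⟩ := Submodule.mem_span_singleton.1 (hv x)
    obtain ⟨l, hl⟩ := Submodule.mem_span_singleton.1 (hv y)
    have hk0 : k ≠ 0 := by rintro rfl; exact hx (by rw [← hk, zero_smul])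
    refine Submodule.mem_span_singleton.2 ⟨l * k⁻¹, ?_⟩
    rw [← hk, ← hl, smul_smul, mul_assoc, inv_mul_cancel₀ hk0, mul_one]
  -- operators with different image lines have the same kernel
  have ker : ∀ a c x y, B a y ≠ 0 → B a x = 0 → B c x ∉ K ∙ B a y → False := by
    intro a c x y hy hx hc
    have hcx : B c x ≠ 0 := fun h0 => hc (h0 ▸ Submodule.zero_mem _)
    have h1 : B (a + c) x = B c x := by simp [hx]
    have h2 := dep (a + c) x y (by rwa [h1])
    rw [h1] at h2
    have h3 : B a y ∈ K ∙ B c x := by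
      have := Submodule.sub_mem _ h2 (dep c x y hcx)
      simpa using this
    obtain ⟨k, hk⟩ := Submodule.mem_span_singleton.1 h3
    have hk0 : k ≠ 0 := by rintro rfl; exact hy (by rw [← hk, zero_smul])
    apply hc
    refine Submodule.mem_span_singleton.2 ⟨k⁻¹, ?_⟩
    rw [← hk, smul_smul, inv_mul_cancel₀ hk0, one_smul]
  by_cases h0 : ∀ a x, B a x = 0
  · exact Or.inl ⟨0, fun a x => by simp [h0]⟩
  push Not at h0
  obtain ⟨a, x₀, hx₀⟩ := h0
  by_cases h1 : ∀ c x, B c x ∈ K ∙ B a x₀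
  · exact Or.inl ⟨_, h1⟩
  right
  push Not at h1
  obtain ⟨c, x₁, hx₁⟩ := h1
  have hcx₁ : B c x₁ ≠ 0 := fun h0 => hx₁ (h0 ▸ Submodule.zero_mem _)
  have hx₁' : B a x₀ ∉ K ∙ B c x₁ := by
    intro h3
    obtain ⟨k, hk⟩ := Submodule.mem_span_singleton.1 h3
    have hk0 : k ≠ 0 := by rintro rfl; exact hx₀ (by rw [← hk, zero_smul])
    apply hx₁
    refine Submodule.mem_span_singleton.2 ⟨k⁻¹, ?_⟩
    rw [← hk, smul_smul, inv_mul_cancel₀ hk0, one_smul]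
  obtain ⟨g, hg⟩ := Module.Projective.exists_dual_ne_zero K hx₀
  -- `g ∘ B a` is a functional whose kernel is that of `B a`
  refine ⟨g ∘ₗ B a, fun x hx => ?_⟩
  have hax : B a x = 0 := by
    obtain ⟨k, hk⟩ := Submodule.mem_span_singleton.1 (dep a x₀ x hx₀)
    rw [LinearMap.comp_apply, ← hk, map_smul, smul_eq_mul] at hx
    rcases mul_eq_zero.1 hx with h | h
    · rw [← hk, h, zero_smul]
    · exact absurd h hg
  have hcx : B c x = 0 := by
    by_contra hne
    refine ker a c x x₀ hx₀ hax fun hmem => hx₁ ?_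
    have h2 := dep c x x₁ hne
    exact (Submodule.span_singleton_le_iff_mem _ _).2 hmem h2
  intro e
  by_contra hne
  by_cases hm : B e x ∈ K ∙ B a x₀
  · refine ker c e x x₁ hcx₁ hcx fun hm' => ?_
    obtain ⟨k, hk⟩ := Submodule.mem_span_singleton.1 hm
    have hk0 : k ≠ 0 := by rintro rfl; exact hne (by rw [← hk, zero_smul])
    apply hx₁'
    have := Submodule.smul_mem _ k⁻¹ hm'
    rwa [← hk, smul_smul, inv_mul_cancel₀ hk0, one_smul] at this
  · exact ker a e x x₀ hx₀ hax hm

end Subspaces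

/-! ### Subspaces of codimension at most one in a field -/

section Hyperplanes

variable {K F : Type*} [Field K] [Field F] [Algebra K F]

theorem smul_le_of_mem {M : IntermediateField K F} {a : F} (ha : a ∈ M) :
    a • Subalgebra.toSubmodule M.toSubalgebra ≤ Subalgebra.toSubmodule M.toSubalgebra := by
  intro x hx
  obtain ⟨y, hy, rfl⟩ := (Submodule.mem_smul_pointwise_iff_exists _ _ _).1 hx
  exact M.mul_mem ha hy

/-- Two hyperplanes of a subfield `M` differ by a factor: the functionals on `M` form a
one-dimensional `M`-space. -/
theorem exists_eq_smul_of_hyperplanes (M : IntermediateField K F) [FiniteDimensional K M]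
    {S S' : Submodule K F} (hS : S ≤ Subalgebra.toSubmodule M.toSubalgebra)
    (hS' : S' ≤ Subalgebra.toSubmodule M.toSubalgebra)
    (h : finrank K S + 1 = finrank K M) (h' : finrank K S' + 1 = finrank K M) :
    ∃ e : F, e ≠ 0 ∧ S' = e • S := by
  set T : Submodule K M := S.comap M.toSubalgebra.toSubmodule.subtype with hT
  set T' : Submodule K M := S'.comap M.toSubalgebra.toSubmodule.subtype with hT'
  have hfT : finrank K T + 1 = finrank K M := by
    rw [← h]
    congr 1
    exact (Submodule.comapSubtypeEquivOfLe hS).finrank_eq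
  have hfT' : finrank K T' + 1 = finrank K M := by
    rw [← h']
    congr 1
    exact (Submodule.comapSubtypeEquivOfLe hS').finrank_eq
  obtain ⟨f, hf0, hf⟩ := Submodule.exists_le_ker_of_lt_top T
    (lt_top_iff_ne_top.2 fun h => by rw [h, finrank_top] at hfT; omega)
  obtain ⟨g, hg0, hg⟩ := Submodule.exists_le_ker_of_lt_top T'
    (lt_top_iff_ne_top.2 fun h => by rw [h, finrank_top] at hfT'; omega)
  have hker : ∀ (T : Submodule K M) (f : M →ₗ[K] K), f ≠ 0 → T ≤ LinearMap.ker f →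
      finrank K T + 1 = finrank K M → T = LinearMap.ker f := by
    intro T f hf0 hf hfT
    apply Submodule.eq_of_le_of_finrank_le hf
    have h1 := f.finrank_range_add_finrank_ker
    have h2 : finrank K (LinearMap.range f) ≠ 0 := by
      intro h
      rw [Submodule.finrank_eq_zero, LinearMap.range_eq_bot] at h
      exact hf0 h
    omega
  -- every functional on `M` is `x ↦ f (y * x)` for some `y`
  let Φ : M →ₗ[K] Module.Dual K M := (LinearMap.mul K M).compr₂ f
  have hΦ : Function.Injective Φ := by
    rw [← LinearMap.ker_eq_bot, LinearMap.ker_eq_bot']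
    intro y hy
    by_contra hy0
    apply hf0
    ext x
    have := LinearMap.congr_fun hy (y⁻¹ * x)
    simpa [Φ, mul_inv_cancel_left₀ hy0] using this
  have hΦs : Function.Surjective Φ :=
    (LinearMap.injective_iff_surjective_of_finrank_eq_finrank
      (Subspace.dual_finrank_eq).symm).1 hΦ
  obtain ⟨y, hy⟩ := hΦs g
  have hy0 : y ≠ 0 := by
    rintro rfl
    exact hg0 (by rw [← hy, map_zero])
  have hy0' : (y : F) ≠ 0 := fun h => hy0 (Subtype.ext h)
  have hmem : ∀ x : M, (x : F) ∈ S ↔ f x = 0 := by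
    intro x
    have : x ∈ T ↔ x ∈ LinearMap.ker f := by rw [hker T f hf0 hf hfT]
    exact this
  have hmem' : ∀ x : M, (x : F) ∈ S' ↔ f (y * x) = 0 := by
    intro x
    have : x ∈ T' ↔ x ∈ LinearMap.ker g := by rw [hker T' g hg0 hg hfT']
    rw [← hy] at this
    exact this
  refine ⟨(y : F)⁻¹, inv_ne_zero hy0', ?_⟩
  ext x
  rw [mem_smul_iff_inv_mul_mem (inv_ne_zero hy0'), inv_inv]
  constructor
  · intro hx
    have hxM : x ∈ M := hS' hx
    exact (hmem (y * ⟨x, hxM⟩)).2 ((hmem' ⟨x, hxM⟩).1 hx)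
  · intro hx
    have hxM : x ∈ M := by
      have h1 : (y : F) * x ∈ M := hS hx
      have := M.mul_mem (M.inv_mem y.2) h1
      rwa [inv_mul_cancel_left₀ hy0'] at this
    exact (hmem' ⟨x, hxM⟩).2 ((hmem (y * ⟨x, hxM⟩)).1 hx)

theorem smul_line_le {M : IntermediateField K F} {e : F} {S' : Submodule K F}
    (h : ∀ a ∈ M, a * e ∈ S') : e • Subalgebra.toSubmodule M.toSubalgebra ≤ S' := by
  intro x hx
  obtain ⟨y, hy, rfl⟩ := (Submodule.mem_smul_pointwise_iff_exists _ _ _).1 hx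
  rw [smul_eq_mul, mul_comm]
  exact h y hy

/-- If the span of `S'` by every element of the subfield `M` has at most the dimension of `M`, and
`S'` has codimension at most one there, then `S'` lies in a line over `M`: multiplication by the
elements of `M` gives operators of rank at most one from `S'` to `F / S'`. -/
theorem exists_le_smul_of_finrank_sup_le (M : IntermediateField K F) [FiniteDimensional K M]
    {S' : Submodule K F} [FiniteDimensional K S'] (h : finrank K M ≤ finrank K S' + 1)
    (hspan : ∀ a ∈ M, finrank K (S' ⊔ a • S' : Submodule K F) ≤ finrank K M) :
    ∃ e : F, e ≠ 0 ∧ S' ≤ e • Subalgebra.toSubmodule M.toSubalgebra := by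
  have hfinM : ∀ e : F, e ≠ 0 →
      finrank K (e • Subalgebra.toSubmodule M.toSubalgebra : Submodule K F) = finrank K M :=
    fun e he => finrank_smul_submodule _ he
  have hSM : finrank K S' ≤ finrank K M := by
    have := hspan 0 M.zero_mem
    rwa [zero_smul_submodule, sup_bot_eq] at this
  -- a space of dimension at most one lies in a line
  by_cases hS1 : finrank K S' ≤ 1
  · obtain ⟨v, hv⟩ := finrank_le_one_iff.1 hS1
    by_cases hv0 : (v : F) = 0
    · refine ⟨1, one_ne_zero, fun x hx => ?_⟩
      obtain ⟨c, hc⟩ := hv ⟨x, hx⟩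
      have : x = 0 := by
        rw [show x = ((⟨x, hx⟩ : S') : F) from rfl, ← hc, Submodule.coe_smul, hv0, smul_zero]
      rw [this]
      exact Submodule.zero_mem _
    · refine ⟨v, hv0, fun x hx => ?_⟩
      obtain ⟨c, hc⟩ := hv ⟨x, hx⟩
      have : x = (v : F) * algebraMap K F c := by
        rw [show x = ((⟨x, hx⟩ : S') : F) from rfl, ← hc, Submodule.coe_smul, Algebra.smul_def,
          mul_comm]
      rw [this]
      exact mul_mem_smul (M.algebraMap_mem c)
  push Not at hS1
  have hbot : S' ≠ ⊥ := by
    rintro rfl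
    simp at hS1
  obtain ⟨e, he, he0⟩ := Submodule.exists_mem_ne_zero_of_ne_bot hbot
  -- in codimension zero, `S'` is stable under `M`
  rcases hSM.lt_or_eq with hlt | heq
  swap
  · have hle : e • Subalgebra.toSubmodule M.toSubalgebra ≤ S' := by
      refine smul_line_le fun a ha => ?_
      have h1 : S' = S' ⊔ a • S' :=
        Submodule.eq_of_le_of_finrank_le le_sup_left (heq ▸ hspan a ha)
      rw [h1]
      exact le_sup_right (a := S') (mul_mem_smul he)
    refine ⟨e, he0, (Submodule.eq_of_le_of_finrank_le hle ?_).ge⟩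
    rw [hfinM _ he0, heq]
  let B : M →ₗ[K] S' →ₗ[K] (F ⧸ S') :=
    ((LinearMap.mul K F).compr₂ S'.mkQ).domRestrict₁₂ M.toSubalgebra.toSubmodule S'
  have hB : ∀ (a : M) (x : S'), B a x = S'.mkQ (a * x) := fun a x => rfl
  have hrank : ∀ a, ∃ v, ∀ x, B a x ∈ K ∙ v := by
    intro a
    have h1 : finrank K ((S' ⊔ (a : F) • S').map S'.mkQ) ≤ 1 := by
      have h2 := (S'.mkQ.domRestrict (S' ⊔ (a : F) • S')).finrank_range_add_finrank_ker
      rw [LinearMap.range_domRestrict, LinearMap.ker_domRestrict, Submodule.ker_mkQ,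
        (Submodule.comapSubtypeEquivOfLe (le_sup_left (a := S'))).finrank_eq] at h2
      have := hspan a a.2
      omega
    obtain ⟨v, hv⟩ := finrank_le_one_iff.1 h1
    refine ⟨v, fun x => ?_⟩
    have hx : B a x ∈ (S' ⊔ (a : F) • S').map S'.mkQ :=
      ⟨_, le_sup_right (a := S') (mul_mem_smul x.2), rfl⟩
    obtain ⟨c, hc⟩ := hv ⟨_, hx⟩
    exact Submodule.mem_span_singleton.2 ⟨c, congrArg Subtype.val hc⟩
  rcases common_line_or_common_kernel B hrank with ⟨v, hv⟩ | ⟨f, hf⟩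
  · -- `M S'` lies in `S' + K v`, whose dimension is at most that of `M`
    obtain ⟨v, rfl⟩ := S'.mkQ_surjective v
    have hle : e • Subalgebra.toSubmodule M.toSubalgebra ≤ S' ⊔ K ∙ v := by
      refine smul_line_le fun a ha => ?_
      obtain ⟨c, hc⟩ := Submodule.mem_span_singleton.1 (hv ⟨a, ha⟩ ⟨e, he⟩)
      rw [hB, ← map_smul, ← sub_eq_zero, ← map_sub, Submodule.mkQ_apply,
        Submodule.Quotient.mk_eq_zero] at hc
      rw [show a * e = -(c • v - a * e) + c • v by ring]
      exact Submodule.add_mem_sup (S'.neg_mem hc)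
        (Submodule.smul_mem _ _ (Submodule.mem_span_singleton_self v))
    refine ⟨e, he0, ?_⟩
    rw [Submodule.eq_of_le_of_finrank_le hle ?_]
    · exact le_sup_left
    · rw [hfinM _ he0]
      have h1 := Submodule.finrank_add_le_finrank_add_finrank S' (K ∙ v)
      have h2 := finrank_span_le_card (R := K) ({v} : Set F)
      rw [Set.toFinset_singleton, Finset.card_singleton] at h2
      omega
  · have hker : finrank K (LinearMap.ker f) ≠ 0 := by
      have h1 := f.finrank_range_add_finrank_ker
      have h2 := (LinearMap.range f).finrank_le
      rw [finrank_self] at h2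
      omega
    rw [Ne, Submodule.finrank_eq_zero] at hker
    obtain ⟨t, ht, ht0⟩ := Submodule.exists_mem_ne_zero_of_ne_bot hker
    have ht0' : (t : F) ≠ 0 := fun h => ht0 (Subtype.ext h)
    have hle : (t : F) • Subalgebra.toSubmodule M.toSubalgebra ≤ S' := by
      refine smul_line_le fun a ha => ?_
      have := hf t ht ⟨a, ha⟩
      rwa [hB, Submodule.mkQ_apply, Submodule.Quotient.mk_eq_zero] at this
    refine ⟨t, ht0', (Submodule.eq_of_le_of_finrank_le hle ?_).ge⟩
    rw [hfinM _ ht0']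
    exact hSM

/-- A subspace of codimension at most one in a subfield `M` is determined, up to a factor, by its
spans. -/
theorem SameSpans.exists_eq_smul_of_le_field {S S' : Submodule K F} [FiniteDimensional K S']
    (M : IntermediateField K F) [FiniteDimensional K M]
    (hS : S ≤ Subalgebra.toSubmodule M.toSubalgebra) (h : finrank K M ≤ finrank K S + 1)
    (hss : SameSpans S S') : ∃ e : F, e ≠ 0 ∧ S' = e • S := by
  have hfin := hss.finrank_eq
  have : FiniteDimensional K (Subalgebra.toSubmodule M.toSubalgebra) :=
    ‹FiniteDimensional K M›
  obtain ⟨e, he, hle⟩ := exists_le_smul_of_finrank_sup_le M (S' := S') (by omega) (by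
    intro a ha
    rw [← hss a]
    exact Submodule.finrank_mono
      (sup_le hS ((smul_le_smul_submodule a hS).trans (smul_le_of_mem ha))))
  have hSM : finrank K S ≤ finrank K M := Submodule.finrank_mono hS
  have hinv : e⁻¹ • S' ≤ Subalgebra.toSubmodule M.toSubalgebra := by
    have := smul_le_smul_submodule e⁻¹ hle
    rwa [smul_smul, inv_mul_cancel₀ he, one_smul] at this
  have hfin' := finrank_smul_submodule S' (inv_ne_zero he)
  suffices ∃ d : F, d ≠ 0 ∧ e⁻¹ • S' = d • S by
    obtain ⟨d, hd, hd'⟩ := this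
    refine ⟨e * d, mul_ne_zero he hd, ?_⟩
    rw [mul_smul, ← hd', smul_smul, mul_inv_cancel₀ he, one_smul]
  rcases Nat.lt_or_ge (finrank K S) (finrank K M) with hlt | hge
  · exact exists_eq_smul_of_hyperplanes M hS hinv (by omega) (by omega)
  · refine ⟨1, one_ne_zero, ?_⟩
    rw [one_smul, Submodule.eq_of_le_of_finrank_le hS hge,
      Submodule.eq_of_le_of_finrank_le hinv (by rw [hfin', ← hfin]; exact hge)]

end Hyperplanes

/-! ### Subspaces whose ratios generate a field of the largest degree -/

section Minimal

variable {K F : Type*} [Field K] [Field F] [Algebra K F]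

theorem finrank_adjoin_simple_le_two {x : F} {k : K} (hk : algebraMap K F k = x ^ 2) :
    FiniteDimensional K K⟮x⟯ ∧ finrank K K⟮x⟯ ≤ 2 := by
  have hmonic : (Polynomial.X ^ 2 - Polynomial.C k).Monic :=
    Polynomial.monic_X_pow_sub_C k two_ne_zero
  have hroot : Polynomial.aeval x (Polynomial.X ^ 2 - Polynomial.C k) = 0 := by simp [hk]
  have hx : IsIntegral K x := ⟨_, hmonic, hroot⟩
  refine ⟨IntermediateField.adjoin.finiteDimensional hx, ?_⟩
  rw [IntermediateField.adjoin.finrank hx]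
  refine (Polynomial.natDegree_le_natDegree (minpoly.min K x hmonic hroot)).trans ?_
  rw [Polynomial.natDegree_X_pow_sub_C]

theorem finrank_adjoin_finset_le (hsq : ∀ x : F, ∃ k : K, algebraMap K F k = x ^ 2)
    (s : Finset F) : FiniteDimensional K (IntermediateField.adjoin K (s : Set F)) ∧
      finrank K (IntermediateField.adjoin K (s : Set F)) ≤ 2 ^ s.card := by
  classical
  induction s using Finset.induction_on with
  | empty =>
    rw [Finset.coe_empty, IntermediateField.adjoin_empty]
    exact ⟨inferInstance, by simp⟩
  | insert x s hx ih =>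
    obtain ⟨h1, h2⟩ := ih
    obtain ⟨k, hk⟩ := hsq x
    obtain ⟨h3, h4⟩ := finrank_adjoin_simple_le_two hk
    have heq : IntermediateField.adjoin K ((insert x s : Finset F) : Set F) =
        K⟮x⟯ ⊔ IntermediateField.adjoin K (s : Set F) := by
      rw [Finset.coe_insert, Set.insert_eq, IntermediateField.adjoin_union]
    rw [heq]
    refine ⟨inferInstance, (IntermediateField.finrank_sup_le _ _).trans ?_⟩
    rw [Finset.card_insert_of_notMem hx, pow_succ, mul_comm (2 ^ _)]
    exact Nat.mul_le_mul h4 h2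

/-- The ratios of a space `H` generate a field of degree at most `2 ^ (dim H - 1)`. -/
theorem exists_field_of_ratios (hsq : ∀ x : F, ∃ k : K, algebraMap K F k = x ^ 2)
    (H : Submodule K F) [FiniteDimensional K H] {h : F} (hH : h ∈ H) (h0 : h ≠ 0) :
    ∃ N : IntermediateField K F, FiniteDimensional K N ∧
      finrank K N ≤ 2 ^ (finrank K H - 1) ∧ ∀ x ∈ H, x / h ∈ N := by
  classical
  obtain ⟨g, hg⟩ := Module.Projective.exists_dual_ne_zero K h0
  let C : Submodule K F := H ⊓ LinearMap.ker g
  have hlt : C < H := by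
    refine lt_of_le_of_ne inf_le_left fun heq => hg ?_
    have : h ∈ C := heq ▸ hH
    exact this.2
  have hfin := Submodule.finrank_lt_finrank_of_lt hlt
  have : FiniteDimensional K C := Submodule.finiteDimensional_of_le hlt.le
  let β := Module.finBasis K C
  let s : Finset F := Finset.univ.image fun i => (β i : F) / h
  have hs : s.card ≤ finrank K C := Finset.card_image_le.trans (by simp)
  obtain ⟨h1, h2⟩ := finrank_adjoin_finset_le hsq s
  refine ⟨_, h1, h2.trans (Nat.pow_le_pow_right two_pos (by omega)), fun x hx => ?_⟩
  set N := IntermediateField.adjoin K (s : Set F)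
  have hC : ∀ c : C, (c : F) / h ∈ N := by
    intro c
    rw [← β.sum_repr c, Submodule.coe_sum, Finset.sum_div]
    refine N.sum_mem fun i _ => ?_
    rw [Submodule.coe_smul, smul_div_assoc]
    refine N.smul_mem (IntermediateField.subset_adjoin K _ ?_)
    exact Finset.mem_coe.2 (Finset.mem_image_of_mem _ (Finset.mem_univ i))
  have hxc : x - (g x * (g h)⁻¹) • h ∈ C := by
    refine ⟨H.sub_mem hx (H.smul_mem _ hH), ?_⟩
    simp [hg]
  have h3 := N.add_mem (hC ⟨_, hxc⟩) (N.algebraMap_mem (g x * (g h)⁻¹))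
  rwa [sub_div, smul_div_assoc, div_self h0, Algebra.smul_def, mul_one, sub_add_cancel] at h3

/-- The products of elements of `T` satisfy only the relations which the exterior square forces:
a relation between at most three products survives contraction with every functional. In
characteristic two this says that `x ∧ y ↦ x * y` is injective from bivectors to `F / K`, as far as
it is needed. -/
def HasIndependentProducts (T : Submodule K F) : Prop :=
  ∀ f : F →ₗ[K] K, ∀ p ∈ T, ∀ q ∈ T, ∀ r ∈ T, ∀ s ∈ T, ∀ u ∈ T, ∀ v ∈ T,
    p * q + r * s = u * v → f p • q + f q • p + f r • s + f s • r = f u • v + f v • u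

theorem HasIndependentProducts.smul {T : Submodule K F} (hT : HasIndependentProducts T) {c : F}
    (hc : c ≠ 0) : HasIndependentProducts (c • T) := by
  intro f p hp q hq r hr s hs u hu v hv h
  rw [mem_smul_iff_inv_mul_mem hc] at hp hq hr hs hu hv
  have h1 := hT (f ∘ₗ LinearMap.mulLeft K c) _ hp _ hq _ hr _ hs _ hu _ hv
    (by linear_combination (c⁻¹ * c⁻¹) * h)
  simp only [LinearMap.comp_apply, LinearMap.mulLeft_apply, mul_inv_cancel_left₀ hc,
    ← mul_smul_comm, ← mul_add] at h1
  exact mul_left_cancel₀ (inv_ne_zero hc) h1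

/-- If the ratios of `T` generate a field of the largest possible degree `2 ^ (dim T - 1)`, then
the products of elements of `T` are independent: for a hyperplane `H` of `T`, an element `t` of `T`
outside of `H` and `h ∈ H`, the elements `1` and `t / h` are independent over `K(H / h)`. -/
theorem hasIndependentProducts_of_degree [CharP F 2]
    (hsq : ∀ x : F, ∃ k : K, algebraMap K F k = x ^ 2)
    (T : Submodule K F) [FiniteDimensional K T]
    (hdeg : ∀ N : IntermediateField K F, FiniteDimensional K N →
      (∀ x ∈ T, ∀ y ∈ T, y ≠ 0 → x / y ∈ N) → 2 ^ (finrank K T - 1) ≤ finrank K N) :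
    HasIndependentProducts T := by
  intro f p hp q hq r hr s hs u hu v hv heq
  by_cases hf : ∀ t ∈ T, f t = 0
  · simp [hf _ hp, hf _ hq, hf _ hr, hf _ hs, hf _ hu, hf _ hv]
  push Not at hf
  obtain ⟨t, ht, hft⟩ := hf
  let H : Submodule K F := T ⊓ LinearMap.ker f
  have hHT : H < T := by
    refine lt_of_le_of_ne inf_le_left fun heq => hft ?_
    have : t ∈ H := heq ▸ ht
    exact this.2
  have hfin := Submodule.finrank_lt_finrank_of_lt hHT
  have : FiniteDimensional K H := Submodule.finiteDimensional_of_le hHT.le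
  have hproj : ∀ x ∈ T, x - (f x * (f t)⁻¹) • t ∈ H := fun x hx =>
    ⟨T.sub_mem hx (T.smul_mem _ ht), by simp [hft]⟩
  have h2 : (2 : F) = 0 := CharTwo.two_eq_zero
  have halg : ∀ (k : K) (x : F), k • x = algebraMap K F k * x := fun k x => Algebra.smul_def k x
  by_cases hH : H = ⊥
  · -- here `T` is the line through `t`, and all contractions vanish
    have hline : ∀ x ∈ T, ∀ y ∈ T, f x • y + f y • x = 0 := by
      intro x hx y hy
      have hx' := hproj x hx
      have hy' := hproj y hy
      rw [hH, Submodule.mem_bot, sub_eq_zero] at hx' hy'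
      have hxy : f x • y = f y • x := by
        conv_lhs => rw [hy']
        conv_rhs => rw [hx']
        rw [smul_smul, smul_smul]
        congr 1
        ring
      rw [hxy, ← two_nsmul, nsmul_eq_mul, Nat.cast_ofNat, h2, zero_mul]
    rw [hline u hu v hv, hline p hp q hq, zero_add, hline r hr s hs]
  obtain ⟨h, hhH, hh0⟩ := Submodule.exists_mem_ne_zero_of_ne_bot hH
  obtain ⟨N, hN, hNfin, hNH⟩ := exists_field_of_ratios hsq H hhH hh0
  have hpos : finrank K H ≠ 0 := by rwa [Ne, Submodule.finrank_eq_zero]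
  have ht' : t / h ∉ N := by
    intro hth
    have hall : ∀ x ∈ T, x / h ∈ N := by
      intro x hx
      have h1 := N.add_mem (hNH _ (hproj x hx)) (N.smul_mem (x := f x * (f t)⁻¹) hth)
      rwa [sub_div, smul_div_assoc, sub_add_cancel] at h1
    have h1 := hdeg N hN fun x hx y hy _ => by
      have := N.div_mem (hall x hx) (hall y hy)
      rwa [div_div_div_cancel_right₀ hh0] at this
    have h3 := (Nat.pow_le_pow_iff_right (by norm_num)).1 (h1.trans hNfin)
    omega
  obtain ⟨τ, hτ⟩ : ∃ τ, τ = t / h := ⟨_, rfl⟩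
  rw [← hτ] at ht'
  obtain ⟨k, hk⟩ := hsq τ
  -- coordinates of an element of `T` with respect to `h * N` and `t`
  have hcoord : ∀ x ∈ T, ∃ X ∈ N, ∃ l : K, f x = f t * l ∧ x = h * (X + algebraMap K F l * τ) := by
    intro x hx
    refine ⟨_, hNH _ (hproj x hx), f x * (f t)⁻¹, by field_simp, ?_⟩
    rw [hτ, halg]
    field_simp
    ring
  obtain ⟨P, hP, p₀, hfp, rfl⟩ := hcoord p hp
  obtain ⟨Q, hQ, q₀, hfq, rfl⟩ := hcoord q hq
  obtain ⟨R, hR, r₀, hfr, rfl⟩ := hcoord r hr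
  obtain ⟨S, hS, s₀, hfs, rfl⟩ := hcoord s hs
  obtain ⟨U, hU, u₀, hfu, rfl⟩ := hcoord u hu
  obtain ⟨V, hV, v₀, hfv, rfl⟩ := hcoord v hv
  have hm := fun l : K => N.algebraMap_mem l
  have heq' : (P + algebraMap K F p₀ * τ) * (Q + algebraMap K F q₀ * τ) +
      (R + algebraMap K F r₀ * τ) * (S + algebraMap K F s₀ * τ) =
      (U + algebraMap K F u₀ * τ) * (V + algebraMap K F v₀ * τ) := by
    apply mul_left_cancel₀ (mul_ne_zero hh0 hh0)
    linear_combination heq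
  -- the coefficient of `τ` in the relation
  obtain ⟨C, hC⟩ : ∃ C, C = algebraMap K F p₀ * Q + algebraMap K F q₀ * P +
      algebraMap K F r₀ * S + algebraMap K F s₀ * R -
      (algebraMap K F u₀ * V + algebraMap K F v₀ * U) := ⟨_, rfl⟩
  have hCN : C ∈ N := by
    rw [hC]
    exact N.sub_mem (N.add_mem (N.add_mem (N.add_mem (N.mul_mem (hm _) hQ) (N.mul_mem (hm _) hP))
      (N.mul_mem (hm _) hS)) (N.mul_mem (hm _) hR))
      (N.add_mem (N.mul_mem (hm _) hV) (N.mul_mem (hm _) hU))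
  have hCτ : C * τ = U * V - P * Q - R * S +
      algebraMap K F (u₀ * v₀ - p₀ * q₀ - r₀ * s₀) * algebraMap K F k := by
    rw [hk, hC]
    simp only [map_sub, map_mul]
    linear_combination heq'
  have hCτN : C * τ ∈ N := by
    rw [hCτ]
    exact N.add_mem (N.sub_mem (N.sub_mem (N.mul_mem hU hV) (N.mul_mem hP hQ)) (N.mul_mem hR hS))
      (N.mul_mem (hm _) (hm _))
  have hC0 : C = 0 := by
    by_contra hne
    apply ht'
    have := N.mul_mem (N.inv_mem hCN) hCτN
    rwa [inv_mul_cancel_left₀ hne] at this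
  rw [hfp, hfq, hfr, hfs, hfu, hfv]
  simp only [halg, map_mul]
  rw [hC] at hC0
  linear_combination (algebraMap K F (f t) * h) * hC0 + (algebraMap K F (f t) * h * τ) *
    (algebraMap K F p₀ * algebraMap K F q₀ + algebraMap K F r₀ * algebraMap K F s₀ -
      algebraMap K F u₀ * algebraMap K F v₀) * h2

/-- In a space with independent products, the factors of a product span a unique plane. -/
theorem HasIndependentProducts.mem_span_pair {T : Submodule K F} (hT : HasIndependentProducts T)
    {a x : F} (h1 : (1 : F) ∈ T) (ha : a ∈ T) (hx : x ∈ T) (hax : a * x ∈ T)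
    (haK : ∀ k : K, algebraMap K F k ≠ a) : x ∈ Submodule.span K {1, a} := by
  by_contra hxs
  obtain ⟨f, hfx, hf⟩ := Submodule.exists_le_ker_of_notMem hxs
  have hf1 : f 1 = 0 := hf (Submodule.subset_span (by simp))
  have hfa : f a = 0 := hf (Submodule.subset_span (by simp))
  have h := hT f a ha x hx 0 T.zero_mem 0 T.zero_mem 1 h1 (a * x) hax (by ring)
  simp only [hf1, hfa, zero_smul, zero_add, map_zero, add_zero] at h
  apply haK ((f x)⁻¹ * f (a * x))
  rw [Algebra.algebraMap_eq_smul_one, mul_smul, ← h, smul_smul, inv_mul_cancel₀ hfx, one_smul]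

theorem three_le_finrank_span {x y z : F} {D : Submodule K F} [FiniteDimensional K D]
    (hx0 : x ≠ 0) (hy : y ∉ Submodule.span K {x}) (hz : z ∉ Submodule.span K {x, y})
    (hxD : x ∈ D) (hyD : y ∈ D) (hzD : z ∈ D) : 3 ≤ finrank K D := by
  have hle2 : Submodule.span K {x, y} ≤ D := by
    rw [Submodule.span_le]; rintro w (rfl | rfl) <;> assumption
  have hlt1 : Submodule.span K {x} < Submodule.span K {x, y} :=
    lt_of_le_of_ne (Submodule.span_mono (by simp))
      fun h => hy (h ▸ Submodule.subset_span (by simp))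
  have hlt2 : Submodule.span K {x, y} < D :=
    lt_of_le_of_ne hle2 fun h => hz (h ▸ hzD)
  have h1 := finrank_span_singleton (K := K) hx0
  have : FiniteDimensional K (Submodule.span K {x, y}) := Submodule.finiteDimensional_of_le hle2
  have h2 := Submodule.finrank_lt_finrank_of_lt hlt1
  have h3 := Submodule.finrank_lt_finrank_of_lt hlt2
  omega

/-- The case `a = 1 * a` of a common factor: if `1, a, z, w` are dependent, the planes spanned by
`1, a` and by `z, w` meet; otherwise contracting `a + z * w = u * v` with the functionals dual to
`a`, `z` and `w` would put three independent elements into the span of `u` and `v`. -/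
theorem HasIndependentProducts.exists_common_factor_of_one_mem {T : Submodule K F}
    (hsq : ∀ x : F, ∃ k : K, algebraMap K F k = x ^ 2)
    (hT : HasIndependentProducts T) {a z w u v : F} (h1 : (1 : F) ∈ T) (ha : a ∈ T) (hz : z ∈ T)
    (hw : w ∈ T) (hu : u ∈ T) (hv : v ∈ T) (h : a + z * w = u * v) :
    ∃ x ∈ T, x ≠ 0 ∧ a * x ∈ T ∧ z * w * x ∈ T := by
  have hsqT : ∀ (y : F) {x : F}, x ∈ T → y ^ 2 * x ∈ T := fun y x hx => mem_of_sq_mul_mem hsq y hx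
  -- a dependence between the two pairs of factors gives a common factor
  have key : ∀ {x : F} {k l m n : K}, x = algebraMap K F k + algebraMap K F l * a →
      x = algebraMap K F m * z + algebraMap K F n * w → x ≠ 0 →
      ∃ x ∈ T, x ≠ 0 ∧ a * x ∈ T ∧ z * w * x ∈ T := by
    intro x k l m n hx hx' hx0
    refine ⟨x, ?_, hx0, ?_, ?_⟩
    · rw [hx, ← mul_one (algebraMap K F k), ← Algebra.smul_def, ← Algebra.smul_def]
      exact T.add_mem (T.smul_mem _ h1) (T.smul_mem _ ha)
    · rw [show a * x = algebraMap K F k * a + algebraMap K F l * (a ^ 2 * 1) by rw [hx]; ring,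
        ← Algebra.smul_def, ← Algebra.smul_def]
      exact T.add_mem (T.smul_mem _ ha) (T.smul_mem _ (hsqT a h1))
    · rw [show z * w * x = algebraMap K F m * (z ^ 2 * w) + algebraMap K F n * (w ^ 2 * z) by
        rw [hx']; ring, ← Algebra.smul_def, ← Algebra.smul_def]
      exact T.add_mem (T.smul_mem _ (hsqT z hw)) (T.smul_mem _ (hsqT w hz))
  have span3 : ∀ {x y y' : F}, x ∈ Submodule.span K {1, y, y'} → ∃ k l m : K,
      x = algebraMap K F k + algebraMap K F l * y + algebraMap K F m * y' := by
    intro x y y' hx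
    obtain ⟨k, l, m, rfl⟩ := Submodule.mem_span_triple.1 hx
    exact ⟨k, l, m, by simp only [Algebra.smul_def, mul_one]⟩
  -- the cases where one of the two planes is degenerate
  have hdeg : ∀ k : K, z * w = algebraMap K F k →
      ∃ x ∈ T, x ≠ 0 ∧ a * x ∈ T ∧ z * w * x ∈ T := by
    intro k hk
    refine ⟨1, h1, one_ne_zero, by rwa [mul_one], ?_⟩
    rw [hk, ← Algebra.smul_def]
    exact T.smul_mem _ h1
  by_cases hz0 : z = 0
  · exact hdeg 0 (by simp [hz0])
  by_cases haz : a ∈ Submodule.span K {1, z, w}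
  · obtain ⟨k, l, m, hkl⟩ := span3 haz
    by_cases hx0 : a - algebraMap K F k = 0
    · refine ⟨z, hz, hz0, ?_, ?_⟩
      · rw [sub_eq_zero.1 hx0, ← Algebra.smul_def]
        exact T.smul_mem _ hz
      · rw [show z * w * z = z ^ 2 * w by ring]
        exact hsqT z hw
    · exact key (k := -k) (l := 1) (m := l) (n := m) (by simp; ring)
        (by linear_combination hkl) hx0
  by_cases hza : z ∈ Submodule.span K {1, w, a}
  · obtain ⟨k, l, m, hkl⟩ := span3 hza
    obtain ⟨j, hj⟩ := hsq w
    by_cases hx0 : z - algebraMap K F l * w = 0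
    · exact hdeg (l * j) (by rw [map_mul, hj]; linear_combination w * hx0)
    · exact key (k := k) (l := m) (m := 1) (n := -l) (by linear_combination hkl)
        (by simp; ring) hx0
  by_cases hwa : w ∈ Submodule.span K {1, z, a}
  · obtain ⟨k, l, m, hkl⟩ := span3 hwa
    obtain ⟨j, hj⟩ := hsq z
    by_cases hx0 : w - algebraMap K F l * z = 0
    · exact hdeg (l * j) (by rw [map_mul, hj]; linear_combination z * hx0)
    · exact key (k := k) (l := m) (m := -l) (n := 1) (by linear_combination hkl)
        (by simp; ring) hx0
  -- otherwise `1, a, z, w` are independent, and contraction puts `1, w, z` into the plane `u, v`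
  exfalso
  have hD : ∀ {y : F} {k : K} (f : F →ₗ[K] K), k ≠ 0 → k • y = f u • v + f v • u →
      y ∈ Submodule.span K {u, v} := by
    intro y k f hk hky
    refine Submodule.mem_span_pair.2 ⟨k⁻¹ * f v, k⁻¹ * f u, ?_⟩
    rw [mul_smul, mul_smul, ← smul_add, add_comm, ← hky, smul_smul, inv_mul_cancel₀ hk, one_smul]
  have contr := fun f : F →ₗ[K] K => hT f a ha 1 h1 z hz w hw u hu v hv (by rw [mul_one, h])
  have h1D : (1 : F) ∈ Submodule.span K {u, v} := by
    obtain ⟨f, hfx, hf⟩ := Submodule.exists_le_ker_of_notMem haz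
    have hf1 : f 1 = 0 := hf (Submodule.subset_span (by simp))
    have hfz : f z = 0 := hf (Submodule.subset_span (by simp))
    have hfw : f w = 0 := hf (Submodule.subset_span (by simp))
    refine hD f hfx ?_
    simpa [hf1, hfz, hfw] using contr f
  have hwD : w ∈ Submodule.span K {u, v} := by
    obtain ⟨f, hfx, hf⟩ := Submodule.exists_le_ker_of_notMem hza
    have hf1 : f 1 = 0 := hf (Submodule.subset_span (by simp))
    have hfa : f a = 0 := hf (Submodule.subset_span (by simp))
    have hfw : f w = 0 := hf (Submodule.subset_span (by simp))
    refine hD f hfx ?_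
    simpa [hf1, hfa, hfw] using contr f
  have hzD : z ∈ Submodule.span K {u, v} := by
    obtain ⟨f, hfx, hf⟩ := Submodule.exists_le_ker_of_notMem hwa
    have hf1 : f 1 = 0 := hf (Submodule.subset_span (by simp))
    have hfa : f a = 0 := hf (Submodule.subset_span (by simp))
    have hfz : f z = 0 := hf (Submodule.subset_span (by simp))
    refine hD f hfx ?_
    simpa [hf1, hfa, hfz] using contr f
  have hfd : FiniteDimensional K (Submodule.span K {u, v}) :=
    FiniteDimensional.span_of_finite K (Set.toFinite _)
  have h3 := three_le_finrank_span (K := K) one_ne_zero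
    (fun hm => hwa (Submodule.span_mono (by simp) hm))
    (fun hm => hza (Submodule.span_mono (by
      rintro y (rfl | rfl) <;> simp) hm)) h1D hwD hzD
  classical
  have h4 := finrank_span_finset_le_card (R := K) ({u, v} : Finset F)
  rw [Finset.coe_pair, Set.finrank] at h4
  have := Finset.card_le_two (a := u) (b := v)
  omega

/-- In a space with independent products, two products whose sum is again a product have a common
factor. -/
theorem HasIndependentProducts.exists_common_factor {T : Submodule K F}
    (hsq : ∀ x : F, ∃ k : K, algebraMap K F k = x ^ 2)
    (hT : HasIndependentProducts T) {a c : F} (ha0 : a ≠ 0)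
    (ha : ∃ x ∈ T, ∃ y ∈ T, a = x * y) (hc : ∃ x ∈ T, ∃ y ∈ T, c = x * y)
    (hac : ∃ x ∈ T, ∃ y ∈ T, a + c = x * y) :
    ∃ x ∈ T, x ≠ 0 ∧ a * x ∈ T ∧ c * x ∈ T := by
  obtain ⟨x, hx, y, hy, rfl⟩ := ha
  obtain ⟨z, hz, w, hw, rfl⟩ := hc
  obtain ⟨u, hu, v, hv, huv⟩ := hac
  have hx0 : x ≠ 0 := left_ne_zero_of_mul ha0
  have hxi : x⁻¹ ≠ 0 := inv_ne_zero hx0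
  have hm : ∀ {t : F}, t ∈ T → x⁻¹ * t ∈ x⁻¹ • T := fun ht => mul_mem_smul ht
  obtain ⟨t, ht, ht0, h1, h2⟩ := (hT.smul hxi).exists_common_factor_of_one_mem hsq
    (a := x⁻¹ * y) (z := x⁻¹ * z) (w := x⁻¹ * w) (u := x⁻¹ * u) (v := x⁻¹ * v)
    (by simpa [hx0] using hm hx) (hm hy) (hm hz) (hm hw) (hm hu) (hm hv) (by
      have : x⁻¹ * y = x⁻¹ * x⁻¹ * (x * y) := by field_simp
      rw [this]
      linear_combination x⁻¹ * x⁻¹ * huv)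
  rw [mem_smul_iff_inv_mul_mem hxi, inv_inv] at ht h1 h2
  refine ⟨x * t, ht, mul_ne_zero hx0 ht0, ?_, ?_⟩
  · have := mem_of_sq_mul_mem hsq x h1
    convert this using 1
    field_simp
  · have := mem_of_sq_mul_mem hsq x h2
    convert this using 1
    field_simp

/-- Spaces with the same spans have the same ratios. -/
theorem SameSpans.exists_mul_mem {S S' : Submodule K F} [FiniteDimensional K S]
    [FiniteDimensional K S'] (h : SameSpans S S') {a x : F} (ha0 : a ≠ 0) (hx0 : x ≠ 0)
    (hx : x ∈ S) (hax : a * x ∈ S) : ∃ y ∈ S', y ≠ 0 ∧ a * y ∈ S' := by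
  have h1 : S ⊓ a • S ≠ ⊥ := by
    intro h
    have : a * x ∈ S ⊓ a • S := ⟨hax, mul_mem_smul hx⟩
    rw [h, Submodule.mem_bot] at this
    exact mul_ne_zero ha0 hx0 this
  have h2 : S' ⊓ a • S' ≠ ⊥ := by
    rw [Ne, ← Submodule.finrank_eq_zero] at h1 ⊢
    rwa [← h.finrank_inf_eq ha0]
  obtain ⟨y, ⟨hy, hy'⟩, hy0⟩ := Submodule.exists_mem_ne_zero_of_ne_bot h2
  obtain ⟨z, hz, rfl⟩ := (Submodule.mem_smul_pointwise_iff_exists _ _ _).1 hy'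
  exact ⟨z, hz, by rintro rfl; simp at hy0, hy⟩

/-- A space `S ∋ 1` which is not contained in a field `K(a, c)` is determined up to a factor by its
spans among the spaces with independent products: any two elements of `S` are products from `S'`
with a common factor, and this factor can be chosen the same for all elements. -/
theorem SameSpans.exists_eq_smul_of_hasIndependentProducts {S S' : Submodule K F}
    [FiniteDimensional K S] [FiniteDimensional K S']
    (hsq : ∀ x : F, ∃ k : K, algebraMap K F k = x ^ 2) (h1 : (1 : F) ∈ S)
    (hss : SameSpans S S') (hS' : HasIndependentProducts S')
    (hlarge : ∀ a c : F, ¬ S ≤ Subalgebra.toSubmodule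
      (IntermediateField.adjoin K {a, c}).toSubalgebra) :
    ∃ e : F, e ≠ 0 ∧ S' = e • S := by
  have hprod : ∀ {T : Submodule K F}, FiniteDimensional K T → SameSpans S T →
      ∀ a ∈ S, ∃ x ∈ T, ∃ y ∈ T, a = x * y := by
    intro T _ hST a ha
    by_cases ha0 : a = 0
    · exact ⟨0, T.zero_mem, 0, T.zero_mem, by simp [ha0]⟩
    obtain ⟨y, hy, hy0, hay⟩ := hST.exists_mul_mem ha0 one_ne_zero h1 (by rwa [mul_one])
    refine ⟨_, hay, _, mem_of_sq_mul_mem hsq y⁻¹ hy, ?_⟩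
    field_simp
  have hcommon : ∀ {T : Submodule K F}, FiniteDimensional K T → SameSpans S T →
      HasIndependentProducts T → ∀ a ∈ S, a ≠ 0 → ∀ c ∈ S,
      ∃ x ∈ T, x ≠ 0 ∧ a * x ∈ T ∧ c * x ∈ T := by
    intro T _ hST hT a ha ha0 c hc
    exact hT.exists_common_factor hsq ha0 (hprod ‹_› hST a ha) (hprod ‹_› hST c hc)
      (hprod ‹_› hST _ (S.add_mem ha hc))
  obtain ⟨a, ha, haK⟩ := SetLike.not_le_iff_exists.1 (hlarge 0 0)
  have haK' : ∀ k : K, algebraMap K F k ≠ a := by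
    rintro k rfl
    exact haK (IntermediateField.algebraMap_mem _ k)
  have ha0 : a ≠ 0 := by simpa using (haK' 0).symm
  obtain ⟨c, hc, hca⟩ := SetLike.not_le_iff_exists.1 (hlarge a a)
  replace hca : c ∉ IntermediateField.adjoin K {a, a} := hca
  have hcK' : ∀ k : K, algebraMap K F k ≠ c := by
    rintro k rfl
    exact hca (IntermediateField.algebraMap_mem _ k)
  have hc0 : c ≠ 0 := by simpa using (hcK' 0).symm
  obtain ⟨e, he, he0, hae, hce⟩ := hcommon ‹_› hss hS' a ha ha0 c hc
  -- after division by the common factor `e`, the space `T` contains `1`, `a` and `c`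
  have hei : e⁻¹ ≠ 0 := inv_ne_zero he0
  set T : Submodule K F := e⁻¹ • S' with hTdef
  have hT : HasIndependentProducts T := hS'.smul hei
  have hST : SameSpans S T := hss.trans (sameSpans_smul S' hei).symm
  have memT : ∀ {x}, x ∈ T ↔ x * e ∈ S' := by
    intro x
    rw [hTdef, mem_smul_iff_inv_mul_mem hei, inv_inv, mul_comm]
  have h1T : (1 : F) ∈ T := memT.2 (by rwa [one_mul])
  have haT : a ∈ T := memT.2 hae
  have hcT : c ∈ T := memT.2 hce
  set A := IntermediateField.adjoin K {a, c} with hA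
  have haA : a ∈ A := IntermediateField.subset_adjoin K _ (by simp)
  have hcA : c ∈ A := IntermediateField.subset_adjoin K _ (by simp)
  have hdich : ∀ d ∈ S, d ∉ T → d ∈ A := by
    intro d hd hdT
    obtain ⟨p, hp, hp0, hap, hdp⟩ := hcommon (finiteDimensional_smul S' e⁻¹) hST hT a ha ha0 d hd
    obtain ⟨q, hq, hq0, hcq, hdq⟩ := hcommon (finiteDimensional_smul S' e⁻¹) hST hT c hc hc0 d hd
    obtain ⟨k, l, hkl⟩ := Submodule.mem_span_pair.1 (hT.mem_span_pair h1T haT hp hap haK')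
    obtain ⟨m, n, hmn⟩ := Submodule.mem_span_pair.1 (hT.mem_span_pair h1T hcT hq hcq hcK')
    simp only [Algebra.smul_def, mul_one] at hkl hmn
    have hpA : p ∈ A := hkl ▸ A.add_mem (A.algebraMap_mem _) (A.mul_mem (A.algebraMap_mem _) haA)
    have hqA : q ∈ A := hmn ▸ A.add_mem (A.algebraMap_mem _) (A.mul_mem (A.algebraMap_mem _) hcA)
    have hn : n ≠ 0 := by
      rintro rfl
      rw [map_zero, zero_mul, add_zero] at hmn
      apply hdT
      have hm : m ≠ 0 := by rintro rfl; exact hq0 (by rw [← hmn, map_zero])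
      rw [← hmn, mul_comm, ← Algebra.smul_def] at hdq
      exact (T.smul_mem_iff hm).1 hdq
    have hpi := inv_ne_zero hp0
    have memT' : ∀ {x}, x ∈ p⁻¹ • T ↔ x * p ∈ T := by
      intro x
      rw [mem_smul_iff_inv_mul_mem hpi, inv_inv, mul_comm]
    have hspan := (hT.smul hpi).mem_span_pair (a := q / p) (x := d) (memT'.2 (by rwa [one_mul]))
      (memT'.2 (by rwa [div_mul_cancel₀ _ hp0])) (memT'.2 hdp)
      (memT'.2 (by rwa [show q / p * d * p = d * q by field_simp])) (by
        -- if `q` were a multiple of `p`, then `c` would lie in `K(a)`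
        intro j hj
        rw [eq_div_iff hp0] at hj
        apply hca
        have hn' : algebraMap K F n ≠ 0 := by simpa using hn
        have hceq : c = (algebraMap K F n)⁻¹ *
            (algebraMap K F j * (algebraMap K F k + algebraMap K F l * a) - algebraMap K F m) := by
          rw [hkl, hj, ← hmn]
          field_simp
          ring
        rw [hceq]
        have hm := fun l : K => (IntermediateField.adjoin K {a, a}).algebraMap_mem l
        exact mul_mem (inv_mem (hm _)) (sub_mem (mul_mem (hm _) (add_mem (hm _)
          (mul_mem (hm _) (IntermediateField.subset_adjoin K _ (by simp))))) (hm _)))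
    obtain ⟨i, j, hij⟩ := Submodule.mem_span_pair.1 hspan
    rw [← hij]
    exact A.add_mem (A.smul_mem A.one_mem) (A.smul_mem (A.div_mem hqA hpA))
  -- `S` is not the union of two proper subspaces
  have hle : S ≤ T := by
    intro d hd
    by_contra hdT
    obtain ⟨g, hg, hgA⟩ := SetLike.not_le_iff_exists.1 (hlarge a c)
    replace hgA : g ∉ A := hgA
    have hgT : g ∈ T := by
      by_contra hgT
      exact hgA (hdich g hg hgT)
    have hdA := hdich d hd hdT
    have hsum : d + g ∉ T := fun h => hdT (by simpa using T.sub_mem h hgT)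
    exact hgA (by simpa using A.sub_mem (hdich _ (S.add_mem hd hg) hsum) hdA)
  refine ⟨e, he0, ?_⟩
  rw [Submodule.eq_of_le_of_finrank_eq hle hST.finrank_eq, hTdef, smul_smul, mul_inv_cancel₀ he0,
    one_smul]

/-- A space whose ratios generate a field of the largest possible degree is determined by its
spans, up to a factor. In dimension at most three it has codimension at most one in that field. -/
theorem SameSpans.exists_eq_smul_of_degree [CharP F 2] {S S' : Submodule K F}
    [FiniteDimensional K S] [FiniteDimensional K S']
    (hsq : ∀ x : F, ∃ k : K, algebraMap K F k = x ^ 2) (hss : SameSpans S S')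
    (hpos : 0 < finrank K S) (hdeg : finrank K (IntermediateField.adjoin K
      {z : F | ∃ x ∈ S, ∃ y ∈ S, x ≠ 0 ∧ y ≠ 0 ∧ z = x / y}) = 2 ^ (finrank K S - 1)) :
    ∃ e : F, e ≠ 0 ∧ S' = e • S := by
  set N := IntermediateField.adjoin K
    {z : F | ∃ x ∈ S, ∃ y ∈ S, x ≠ 0 ∧ y ≠ 0 ∧ z = x / y} with hN
  have hNfd : FiniteDimensional K N := FiniteDimensional.of_finrank_pos (by rw [hdeg]; positivity)
  have hbot : S ≠ ⊥ := by rintro rfl; simp at hpos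
  obtain ⟨g, hg, hg0⟩ := Submodule.exists_mem_ne_zero_of_ne_bot hbot
  have hgi := inv_ne_zero hg0
  have hss1 : SameSpans (g⁻¹ • S) S' := (sameSpans_smul S hgi).trans hss
  have hfin1 := finrank_smul_submodule S hgi
  have h1 : (1 : F) ∈ g⁻¹ • S := by
    rw [mem_smul_iff_inv_mul_mem hgi, inv_inv, mul_one]
    exact hg
  have hSN : g⁻¹ • S ≤ Subalgebra.toSubmodule N.toSubalgebra := by
    intro x hx
    rw [mem_smul_iff_inv_mul_mem hgi, inv_inv] at hx
    by_cases hx0 : x = 0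
    · rw [hx0]; exact Submodule.zero_mem _
    · exact IntermediateField.subset_adjoin K _
        ⟨_, hx, g, hg, mul_ne_zero hg0 hx0, hg0, by field_simp⟩
  suffices ∃ e : F, e ≠ 0 ∧ S' = e • g⁻¹ • S by
    obtain ⟨e, he, he'⟩ := this
    exact ⟨e * g⁻¹, mul_ne_zero he hgi, by rw [mul_smul, he']⟩
  rcases Nat.lt_or_ge 3 (finrank K S) with hlt | hle
  · refine hss1.exists_eq_smul_of_hasIndependentProducts hsq h1 ?_ ?_
    · refine hasIndependentProducts_of_degree hsq S' fun N' hN' hratio => ?_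
      rw [← hss.finrank_eq, ← hdeg]
      have hNN' : N ≤ N' := by
        rw [hN, IntermediateField.adjoin_le_iff]
        rintro z ⟨x, hx, y, hy, hx0, hy0, rfl⟩
        obtain ⟨w, hw, hw0, hzw⟩ := hss.exists_mul_mem (div_ne_zero hx0 hy0) hy0 hy
          (by rwa [div_mul_cancel₀ _ hy0])
        have := hratio _ hzw _ hw hw0
        rwa [mul_div_cancel_right₀ _ hw0] at this
      exact LinearMap.finrank_le_finrank_of_injective
        (f := (IntermediateField.inclusion hNN').toLinearMap)
        (IntermediateField.inclusion_injective hNN')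
    · intro a c hac
      classical
      have hNA : N ≤ IntermediateField.adjoin K {a, c} := by
        rw [hN, IntermediateField.adjoin_le_iff]
        rintro z ⟨x, hx, y, hy, hx0, hy0, rfl⟩
        have hx' : g⁻¹ * x ∈ IntermediateField.adjoin K {a, c} := hac (mul_mem_smul hx)
        have hy' : g⁻¹ * y ∈ IntermediateField.adjoin K {a, c} := hac (mul_mem_smul hy)
        have := div_mem hx' hy'
        rwa [mul_div_mul_left _ _ hgi] at this
      obtain ⟨h2, h3⟩ := finrank_adjoin_finset_le hsq ({a, c} : Finset F)
      rw [Finset.coe_pair] at h2 h3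
      have h4 := LinearMap.finrank_le_finrank_of_injective
        (f := (IntermediateField.inclusion hNA).toLinearMap)
        (IntermediateField.inclusion_injective hNA)
      have h5 : (2 : ℕ) ^ ({a, c} : Finset F).card ≤ 2 ^ 2 :=
        Nat.pow_le_pow_right two_pos Finset.card_le_two
      have h6 : (2 : ℕ) ^ 3 ≤ 2 ^ (finrank K S - 1) := Nat.pow_le_pow_right two_pos (by omega)
      rw [hdeg] at h4
      omega
  · refine hss1.exists_eq_smul_of_le_field N hSN ?_
    rw [hfin1, hdeg]
    generalize finrank K S = n at hpos hle
    interval_cases n <;> norm_num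

end Minimal

/-! ### Totally singular forms -/

section Forms

variable {F : Type*} [Field F] {V : Type*} [AddCommGroup V] [Module F V]
  {W : Type*} [AddCommGroup W] [Module F W]

theorem IsTotallySingular.apply_sum {φ : QuadraticForm F V} (hφ : IsTotallySingular φ) {ι : Type*}
    (s : Finset ι) (f : ι → V) : φ (∑ i ∈ s, f i) = ∑ i ∈ s, φ (f i) :=
  map_sum (AddMonoidHom.mk' φ hφ) f s

theorem isTotallySingular_smul {φ : QuadraticForm F V} (hφ : IsTotallySingular φ) (c : F) :
    IsTotallySingular (c • φ) := fun x y => by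
  simp only [smul_apply, hφ x y, smul_add]

theorem isTotallySingular_prod {φ : QuadraticForm F V} (hφ : IsTotallySingular φ)
    {ψ : QuadraticForm F W} (hψ : IsTotallySingular ψ) :
    IsTotallySingular (QuadraticMap.prod φ ψ) := fun x y => by
  simp only [QuadraticMap.prod_apply, Prod.fst_add, Prod.snd_add, hφ x.1 y.1, hψ x.2 y.2]
  ring

theorem isTotallySingular_of_isometry {φ : QuadraticForm F V} {ψ : QuadraticForm F W}
    (hψ : IsTotallySingular ψ) (f : V →ₗ[F] W) (hf : ∀ x, ψ (f x) = φ x) :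
    IsTotallySingular φ := fun x y => by
  rw [← hf, ← hf, ← hf, map_add, hψ]

theorem defect_le_of_isSubform [FiniteDimensional F W] {φ : QuadraticForm F V}
    {ψ : QuadraticForm F W} (hφ : IsTotallySingular φ) (hψ : IsTotallySingular ψ)
    (h : IsSubform φ ψ) : defect φ hφ ≤ defect ψ hψ := by
  obtain ⟨f, hf, hfx⟩ := h
  refine LinearMap.finrank_le_finrank_of_injective
    (f := f.restrict (p := zeroSpace φ hφ) (q := zeroSpace ψ hψ) fun x hx => ?_) ?_
  · change ψ (f x) = 0
    rw [hfx]
    exact hx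
  · intro x y hxy
    exact Subtype.ext (hf (congrArg Subtype.val hxy))

theorem defect_eq_zero_of_anisotropic {φ : QuadraticForm F V} (hφ : IsTotallySingular φ)
    (h : φ.Anisotropic) : defect φ hφ = 0 := by
  have : zeroSpace φ hφ = ⊥ := by
    rw [Submodule.eq_bot_iff]
    exact fun x hx => h x hx
  rw [defect, this, finrank_bot]

end Forms

/-! ### The space of values -/

section Values

variable {F : Type*} [Field F] [CharP F 2] {V : Type*} [AddCommGroup V] [Module F V]
  {W : Type*} [AddCommGroup W] [Module F W]

theorem exists_fieldRange_eq_sq (x : F) :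
    ∃ k : (frobenius F 2).fieldRange, algebraMap (frobenius F 2).fieldRange F k = x ^ 2 :=
  ⟨⟨x ^ 2, x, rfl⟩, rfl⟩

theorem map_smul_eq_frobenius (φ : QuadraticForm F V) (r : F) (x : V) :
    φ (r • x) = frobenius F 2 r * φ x := by
  rw [QuadraticMap.map_smul, frobenius_def, sq, smul_eq_mul]

/-- The values of a totally singular form, as a subspace of `F` over `F²`. -/
def valueSpace (φ : QuadraticForm F V) (hφ : IsTotallySingular φ) :
    Submodule (frobenius F 2).fieldRange F where
  carrier := Set.range φ
  zero_mem' := ⟨0, QuadraticMap.map_zero φ⟩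
  add_mem' := by
    rintro _ _ ⟨x, rfl⟩ ⟨y, rfl⟩
    exact ⟨x + y, hφ x y⟩
  smul_mem' := by
    rintro ⟨_, r, rfl⟩ _ ⟨x, rfl⟩
    refine ⟨r • x, ?_⟩
    exact map_smul_eq_frobenius φ r x

theorem mem_valueSpace {φ : QuadraticForm F V} {hφ : IsTotallySingular φ} {z : F} :
    z ∈ valueSpace φ hφ ↔ ∃ x, φ x = z := Iff.rfl

theorem apply_mem_valueSpace {φ : QuadraticForm F V} (hφ : IsTotallySingular φ) (x : V) :
    φ x ∈ valueSpace φ hφ := ⟨x, rfl⟩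

theorem isTotallySingular_pfister {n : ℕ} (a : Fin n → F) : IsTotallySingular (pfister a) := by
  intro x y
  simp only [pfister, QuadraticMap.weightedSumSquares_apply, ← Finset.sum_add_distrib, ← smul_add,
    Pi.add_apply, CharTwo.add_mul_self]

theorem valueSpace_smul {φ : QuadraticForm F V} (hφ : IsTotallySingular φ) (c : F) :
    valueSpace (c • φ) (isTotallySingular_smul hφ c) = c • valueSpace φ hφ := by
  ext z
  rw [Submodule.mem_smul_pointwise_iff_exists, mem_valueSpace]
  constructor
  · rintro ⟨x, rfl⟩
    exact ⟨φ x, ⟨x, rfl⟩, rfl⟩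
  · rintro ⟨_, ⟨x, rfl⟩, rfl⟩
    exact ⟨x, rfl⟩

theorem valueSpace_prod {φ : QuadraticForm F V} (hφ : IsTotallySingular φ)
    {ψ : QuadraticForm F W} (hψ : IsTotallySingular ψ) :
    valueSpace (QuadraticMap.prod φ ψ) (isTotallySingular_prod hφ hψ) =
      valueSpace φ hφ ⊔ valueSpace ψ hψ := by
  ext z
  rw [Submodule.mem_sup, mem_valueSpace]
  constructor
  · rintro ⟨⟨x, y⟩, rfl⟩
    exact ⟨φ x, ⟨x, rfl⟩, ψ y, ⟨y, rfl⟩, rfl⟩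
  · rintro ⟨_, ⟨x, rfl⟩, _, ⟨y, rfl⟩, rfl⟩
    exact ⟨(x, y), rfl⟩

theorem valueSpace_le_of_isometry {φ : QuadraticForm F V} {ψ : QuadraticForm F W}
    (hφ : IsTotallySingular φ) (hψ : IsTotallySingular ψ) (f : V →ₗ[F] W)
    (hf : ∀ x, ψ (f x) = φ x) : valueSpace φ hφ ≤ valueSpace ψ hψ := by
  rintro _ ⟨x, rfl⟩
  exact ⟨f x, hf x⟩

theorem valueSpace_eq_of_equivalent {φ : QuadraticForm F V} {ψ : QuadraticForm F W}
    (hφ : IsTotallySingular φ) (hψ : IsTotallySingular ψ) (h : QuadraticMap.Equivalent φ ψ) :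
    valueSpace φ hφ = valueSpace ψ hψ := by
  obtain ⟨e⟩ := h
  apply le_antisymm
  · exact valueSpace_le_of_isometry hφ hψ (e.toLinearEquiv : V →ₗ[F] W) e.map_app
  · exact valueSpace_le_of_isometry hψ hφ (e.symm.toLinearEquiv : W →ₗ[F] V) e.symm.map_app

/-- On a complement of its zero space, a totally singular form is a Frobenius-semilinear bijection
onto its values. -/
theorem bijective_of_isCompl_zeroSpace (φ : QuadraticForm F V) (hφ : IsTotallySingular φ)
    {C : Submodule F V} (hC : IsCompl C (zeroSpace φ hφ)) :
    Function.Bijective fun x : C => (⟨φ x, apply_mem_valueSpace hφ x⟩ : valueSpace φ hφ) := by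
  constructor
  · intro x y hxy
    have h1 : φ (x : V) = φ (y : V) := congrArg Subtype.val hxy
    have h2 : ((x - y : C) : V) ∈ zeroSpace φ hφ := by
      change φ ((x - y : C) : V) = 0
      rw [Submodule.coe_sub, sub_eq_add_neg, hφ, QuadraticMap.map_neg, h1, CharTwo.add_self_eq_zero]
    have h3 : ((x - y : C) : V) ∈ C ⊓ zeroSpace φ hφ := ⟨(x - y).2, h2⟩
    rw [hC.inf_eq_bot, Submodule.mem_bot] at h3
    exact sub_eq_zero.1 (Subtype.ext h3)
  · rintro ⟨_, x, rfl⟩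
    have hx : x ∈ C ⊔ zeroSpace φ hφ := by rw [hC.sup_eq_top]; trivial
    obtain ⟨y, hy, z, hz, rfl⟩ := Submodule.mem_sup.1 hx
    refine ⟨⟨y, hy⟩, Subtype.ext ?_⟩
    have hz' : φ z = 0 := hz
    simp only [hφ y z, hz', add_zero]

theorem finrank_eq_of_isCompl_zeroSpace (φ : QuadraticForm F V) (hφ : IsTotallySingular φ)
    {C : Submodule F V} (hC : IsCompl C (zeroSpace φ hφ)) :
    finrank F C = finrank (frobenius F 2).fieldRange (valueSpace φ hφ) := by
  let j : C ≃+ valueSpace φ hφ := AddEquiv.ofBijective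
    (AddMonoidHom.mk' (fun x : C => (⟨φ x, apply_mem_valueSpace hφ x⟩ : valueSpace φ hφ))
      fun x y => Subtype.ext (hφ x y)) (bijective_of_isCompl_zeroSpace φ hφ hC)
  have h := lift_rank_eq_of_equiv_equiv (R := F) (R' := (frobenius F 2).fieldRange)
    (fun r => ⟨frobenius F 2 r, r, rfl⟩) j
    ⟨fun r s h => (frobenius F 2).injective (congrArg Subtype.val h), by
      rintro ⟨_, r, rfl⟩
      exact ⟨r, rfl⟩⟩
    (fun r x => Subtype.ext (by
      exact map_smul_eq_frobenius φ r (x : V)))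
  have h2 := congrArg Cardinal.toNat h
  rwa [Cardinal.toNat_lift, Cardinal.toNat_lift] at h2

/-- Rank-nullity for totally singular forms: the dimension is the dimension of the space of values
plus the defect. -/
theorem finrank_valueSpace_add_defect [FiniteDimensional F V] (φ : QuadraticForm F V)
    (hφ : IsTotallySingular φ) :
    finrank (frobenius F 2).fieldRange (valueSpace φ hφ) + defect φ hφ = finrank F V := by
  obtain ⟨C, hC⟩ := (zeroSpace φ hφ).exists_isCompl
  rw [← finrank_eq_of_isCompl_zeroSpace φ hφ hC.symm, add_comm]
  exact Submodule.finrank_add_eq_of_isCompl hC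

instance finiteDimensional_valueSpace [FiniteDimensional F V] (φ : QuadraticForm F V)
    (hφ : IsTotallySingular φ) :
    FiniteDimensional (frobenius F 2).fieldRange (valueSpace φ hφ) := by
  classical
  let β := Module.finBasis F V
  have hle : valueSpace φ hφ ≤ Submodule.span (frobenius F 2).fieldRange
      (Set.range fun i => φ (β i)) := by
    rintro _ ⟨x, rfl⟩
    rw [← β.sum_repr x, hφ.apply_sum]
    refine Submodule.sum_mem _ fun i _ => ?_
    rw [map_smul_eq_frobenius]
    exact Submodule.smul_mem _ (⟨_, _, rfl⟩ : (frobenius F 2).fieldRange)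
      (Submodule.subset_span ⟨i, rfl⟩)
  have := FiniteDimensional.span_of_finite (frobenius F 2).fieldRange
    (Set.finite_range fun i => φ (β i))
  exact Submodule.finiteDimensional_of_le hle

/-- Totally singular forms are classified by their dimension and their space of values. -/
theorem equivalent_of_valueSpace_eq [FiniteDimensional F V] [FiniteDimensional F W]
    {φ : QuadraticForm F V} {ψ : QuadraticForm F W} (hφ : IsTotallySingular φ)
    (hψ : IsTotallySingular ψ) (hdim : finrank F V = finrank F W)
    (h : valueSpace φ hφ = valueSpace ψ hψ) : QuadraticMap.Equivalent φ ψ := by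
  obtain ⟨C, hC⟩ := (zeroSpace φ hφ).exists_isCompl
  obtain ⟨D, hD⟩ := (zeroSpace ψ hψ).exists_isCompl
  have hbij := bijective_of_isCompl_zeroSpace ψ hψ hD.symm
  have hex : ∀ x : C, ∃ y : D, ψ y = φ x := by
    intro x
    have hx : φ x ∈ valueSpace ψ hψ := h ▸ apply_mem_valueSpace hφ (x : V)
    obtain ⟨y, hy⟩ := hbij.2 ⟨_, hx⟩
    exact ⟨y, congrArg Subtype.val hy⟩
  have huniq : ∀ y z : D, ψ y = ψ z → y = z := fun y z hyz => hbij.1 (Subtype.ext hyz)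
  choose g hg using hex
  let G : C →ₗ[F] D :=
    { toFun := g
      map_add' := fun x y => huniq _ _ (by
        rw [hg, Submodule.coe_add, Submodule.coe_add, hφ, hψ, hg, hg])
      map_smul' := fun r x => huniq _ _ (by
        rw [hg, RingHom.id_apply, Submodule.coe_smul, Submodule.coe_smul, QuadraticMap.map_smul,
          QuadraticMap.map_smul, hg]) }
  have hG : Function.Injective G := by
    intro x y hxy
    refine (bijective_of_isCompl_zeroSpace φ hφ hC.symm).1 (Subtype.ext ?_)
    change φ (x : V) = φ (y : V)
    rw [← hg x, ← hg y]
    exact congrArg (fun z : D => ψ (z : W)) hxy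
  have hCD : finrank F C = finrank F D := by
    rw [finrank_eq_of_isCompl_zeroSpace φ hφ hC.symm, finrank_eq_of_isCompl_zeroSpace ψ hψ hD.symm,
      h]
  have hZ : finrank F (zeroSpace φ hφ) = finrank F (zeroSpace ψ hψ) := by
    have h1 := Submodule.finrank_add_eq_of_isCompl hC
    have h2 := Submodule.finrank_add_eq_of_isCompl hD
    omega
  let e : V ≃ₗ[F] W := (Submodule.prodEquivOfIsCompl _ _ hC).symm ≪≫ₗ
    (LinearEquiv.prodCongr (LinearEquiv.ofFinrankEq _ _ hZ)
      (LinearEquiv.ofInjectiveOfFinrankEq G hG hCD)) ≪≫ₗ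
    Submodule.prodEquivOfIsCompl _ _ hD
  refine ⟨⟨e, fun x => ?_⟩⟩
  obtain ⟨⟨z, c⟩, rfl⟩ := (Submodule.prodEquivOfIsCompl _ _ hC).surjective x
  have hz : ∀ z : zeroSpace φ hφ, φ (z : V) = 0 := fun z => z.2
  have hz' : ∀ z : zeroSpace ψ hψ, ψ (z : W) = 0 := fun z => z.2
  have he : e (Submodule.prodEquivOfIsCompl _ _ hC (z, c)) =
      (LinearEquiv.ofFinrankEq _ _ hZ z : W) + (g c : W) := by
    simp only [e, LinearEquiv.trans_apply, LinearEquiv.symm_apply_apply]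
    rfl
  change ψ (e _) = _
  rw [he, hψ, hz', hg, Submodule.coe_prodEquivOfIsCompl', hφ, hz]

theorem isSimilar_of_valueSpace_eq [FiniteDimensional F V] [FiniteDimensional F W]
    {φ : QuadraticForm F V} {ψ : QuadraticForm F W} (hφ : IsTotallySingular φ)
    (hψ : IsTotallySingular ψ) (hdim : finrank F V = finrank F W) {c : F} (hc : c ≠ 0)
    (h : valueSpace φ hφ = c • valueSpace ψ hψ) : IsSimilar φ ψ :=
  ⟨c, hc, equivalent_of_valueSpace_eq hφ (isTotallySingular_smul hψ c) hdim
    (h.trans (valueSpace_smul hψ c).symm)⟩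

/-- The values of a quasi-Pfister form are a field. -/
theorem exists_valueSpace_pfister_eq {n : ℕ} (a : Fin n → F) :
    ∃ M : IntermediateField (frobenius F 2).fieldRange F,
      valueSpace (pfister a) (isTotallySingular_pfister a) =
        Subalgebra.toSubmodule M.toSubalgebra := by
  classical
  set U := valueSpace (pfister a) (isTotallySingular_pfister a) with hU
  have hprod : ∀ I : Finset (Fin n), ∏ i ∈ I, a i ∈ U := by
    intro I
    refine ⟨Pi.single I 1, ?_⟩
    rw [pfister, QuadraticMap.weightedSumSquares_apply, Finset.sum_eq_single I]
    · simp
    · intro J _ hJ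
      simp [Pi.single_eq_of_ne hJ]
    · simp
  have hspan : ∀ x ∈ U, ∃ k : Finset (Fin n) → F, x = ∑ I, k I ^ 2 * ∏ i ∈ I, a i := by
    rintro _ ⟨k, rfl⟩
    refine ⟨k, ?_⟩
    rw [pfister, QuadraticMap.weightedSumSquares_apply]
    exact Finset.sum_congr rfl fun I _ => by rw [smul_eq_mul]; ring
  have hsqU : ∀ (y : F) {x : F}, x ∈ U → y ^ 2 * x ∈ U := fun y x hx =>
    mem_of_sq_mul_mem exists_fieldRange_eq_sq y hx
  -- `∏ I * ∏ J` is the product over the symmetric difference times the square over the intersection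
  have hmul : ∀ I J : Finset (Fin n), (∏ i ∈ I, a i) * ∏ i ∈ J, a i ∈ U := by
    intro I J
    have h1 := Finset.prod_inter_mul_prod_sdiff I J a
    have h2 := Finset.prod_inter_mul_prod_sdiff J I a
    rw [← h1, ← h2, Finset.inter_comm J I]
    have h3 : (∏ i ∈ I \ J, a i) * ∏ i ∈ J \ I, a i = ∏ i ∈ (I \ J) ∪ (J \ I), a i :=
      (Finset.prod_union disjoint_sdiff_sdiff).symm
    have := hsqU (∏ i ∈ I ∩ J, a i) (hprod ((I \ J) ∪ (J \ I)))
    rw [← h3] at this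
    convert this using 1
    ring
  have hmulU : ∀ {x y : F}, x ∈ U → y ∈ U → x * y ∈ U := by
    intro x y hx hy
    obtain ⟨k, rfl⟩ := hspan x hx
    obtain ⟨l, rfl⟩ := hspan y hy
    rw [Finset.sum_mul_sum]
    refine U.sum_mem fun I _ => U.sum_mem fun J _ => ?_
    have := hsqU (k I * l J) (hmul I J)
    convert this using 1
    ring
  have hone : (1 : F) ∈ U := by simpa using hprod ∅
  refine ⟨(U.toSubalgebra hone fun x y => hmulU).toIntermediateField fun x hx => ?_, ?_⟩
  · change x⁻¹ ∈ U
    by_cases hx0 : x = 0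
    · rw [hx0, inv_zero]
      exact U.zero_mem
    · have := hsqU x⁻¹ (x := x) hx
      convert this using 1
      field_simp
  · rfl

theorem IsQuasiPfister.exists_valueSpace_eq {π : QuadraticForm F V} (hπ : IsTotallySingular π)
    (h : IsQuasiPfister π) : ∃ M : IntermediateField (frobenius F 2).fieldRange F,
      valueSpace π hπ = Subalgebra.toSubmodule M.toSubalgebra := by
  obtain ⟨n, a, h⟩ := h
  obtain ⟨M, hM⟩ := exists_valueSpace_pfister_eq a
  exact ⟨M, (valueSpace_eq_of_equivalent hπ (isTotallySingular_pfister a) h).trans hM⟩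

theorem IsQuasiPfister.isTotallySingular {π : QuadraticForm F V} (h : IsQuasiPfister π) :
    IsTotallySingular π := by
  obtain ⟨n, a, ⟨e⟩⟩ := h
  exact isTotallySingular_of_isometry (isTotallySingular_pfister a)
    (e.toLinearEquiv : V →ₗ[F] _) e.map_app

end Values

/-! ### The defect over quadratic extensions -/

section QuadraticExtensions

variable {F : Type*} [Field F] [CharP F 2] {V : Type*} [AddCommGroup V] [Module F V]
  {W : Type*} [AddCommGroup W] [Module F W]

/-- A linear bijection which identifies a totally singular form `χ` over `F` with `φ_E` computes
the defect of `φ_E`. -/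
theorem finrank_mul_defect_baseChange {X : Type*} [AddCommGroup X] [Module F X] (E : Type*)
    [Field E] [Algebra F E] (φ : QuadraticForm F V) (hφ : IsTotallySingular φ)
    (χ : QuadraticForm F X) (hχ : IsTotallySingular χ) (Ψ : X ≃ₗ[F] E ⊗[F] V)
    (h : ∀ x, baseChange E φ hφ (Ψ x) = algebraMap F E (χ x)) :
    finrank F E * defect (baseChange E φ hφ) (baseChange_isTotallySingular E φ hφ) =
      defect χ hχ := by
  set Z := zeroSpace (baseChange E φ hφ) (baseChange_isTotallySingular E φ hφ) with hZ
  have h1 : (zeroSpace χ hχ).map (Ψ : X →ₗ[F] E ⊗[F] V) = Z.restrictScalars F := by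
    ext y
    rw [Submodule.mem_map, Submodule.restrictScalars_mem]
    constructor
    · rintro ⟨x, hx, rfl⟩
      have hx' : χ x = 0 := hx
      change baseChange E φ hφ (Ψ x) = 0
      rw [h, hx', map_zero]
    · intro hy
      refine ⟨Ψ.symm y, ?_, Ψ.apply_symm_apply y⟩
      have hy' : baseChange E φ hφ y = 0 := hy
      rw [← Ψ.apply_symm_apply y, h] at hy'
      exact (map_eq_zero _).1 hy'
  have h2 : finrank F (Z.restrictScalars F) = finrank F (zeroSpace χ hχ) := by
    rw [← h1]
    exact Ψ.finrank_map_eq _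
  have hfree : Module.Free E Z := Module.Free.of_divisionRing E Z
  have h3 : finrank F E * finrank E Z = finrank F Z := finrank_mul_finrank F E Z
  rw [defect, defect, ← h2]
  exact h3

theorem baseChange_one_tmul_add (E : Type*) [Field E] [Algebra F E] (φ : QuadraticForm F V)
    (hφ : IsTotallySingular φ) {a : F} {α : E} (hα : α ^ 2 = algebraMap F E a) (x y : V) :
    baseChange E φ hφ ((1 : E) ⊗ₜ[F] x + α ⊗ₜ[F] y) =
      algebraMap F E (QuadraticMap.prod φ (a • φ) (x, y)) := by
  rw [baseChange_isTotallySingular E φ hφ, baseChange_tmul, baseChange_tmul, hα,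
    QuadraticMap.prod_apply, smul_apply, smul_eq_mul]
  simp

/-- Over a proper quadratic extension `F(√a)`, twice the defect of `φ` is the defect of
`φ ⊥ aφ`. -/
theorem two_mul_defect_baseChange {L : Type*} [Field L] [Algebra F L] (φ : QuadraticForm F V)
    (hφ : IsTotallySingular φ) {a : F} {α : L} (hα : α ^ 2 = algebraMap F L a)
    (hαF : ∀ x : F, algebraMap F L x ≠ α) :
    2 * defect (baseChange F⟮α⟯ φ hφ) (baseChange_isTotallySingular F⟮α⟯ φ hφ) =
      defect (QuadraticMap.prod φ (a • φ))
        (isTotallySingular_prod hφ (isTotallySingular_smul hφ a)) := by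
  let γ : F⟮α⟯ := IntermediateField.AdjoinSimple.gen F α
  have hγ : γ ^ 2 = algebraMap F F⟮α⟯ a := Subtype.ext hα
  have hγF : ∀ x : F, algebraMap F F⟮α⟯ x ≠ γ := fun x h => hαF x (congrArg Subtype.val h)
  obtain ⟨hfd, hle⟩ := finrank_adjoin_simple_le_two hα.symm
  let ε : F × F →ₗ[F] F⟮α⟯ :=
    (LinearMap.toSpanSingleton F F⟮α⟯ 1).coprod (LinearMap.toSpanSingleton F F⟮α⟯ γ)
  have hε : ∀ x y : F, ε (x, y) = x • (1 : F⟮α⟯) + y • γ := fun x y => rfl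
  have hinj : Function.Injective ε := by
    rw [← LinearMap.ker_eq_bot, LinearMap.ker_eq_bot']
    rintro ⟨x, y⟩ h
    rw [hε] at h
    have hy : y = 0 := by
      by_contra hy
      apply hγF (-(y⁻¹ * x))
      rw [Algebra.algebraMap_eq_smul_one, neg_smul, mul_smul, eq_neg_of_add_eq_zero_left h,
        smul_neg, neg_neg, smul_smul, inv_mul_cancel₀ hy, one_smul]
    rw [hy, zero_smul, add_zero, smul_eq_zero] at h
    rw [hy, h.resolve_right one_ne_zero]
    rfl
  have h2 : finrank F (F × F) = 2 := by simp
  have hfin : finrank F F⟮α⟯ = 2 :=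
    le_antisymm hle (h2 ▸ LinearMap.finrank_le_finrank_of_injective hinj)
  let e : (F × F) ≃ₗ[F] F⟮α⟯ := LinearEquiv.ofInjectiveOfFinrankEq ε hinj (h2.trans hfin.symm)
  have he : ∀ z, e z = ε z := fun z => rfl
  let Ψ : (V × V) ≃ₗ[F] F⟮α⟯ ⊗[F] V :=
    ((TensorProduct.lid F V).symm.prodCongr (TensorProduct.lid F V).symm) ≪≫ₗ
      (TensorProduct.prodLeft F F F F V).symm ≪≫ₗ
      TensorProduct.congr e (LinearEquiv.refl F V)
  have hΨ : ∀ x y, Ψ (x, y) = (1 : F⟮α⟯) ⊗ₜ[F] x + γ ⊗ₜ[F] y := by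
    intro x y
    have : ((1 : F) ⊗ₜ[F] x, (1 : F) ⊗ₜ[F] y) =
        TensorProduct.prodLeft F F F F V (((1, 0) : F × F) ⊗ₜ[F] x + ((0, 1) : F × F) ⊗ₜ[F] y) := by
      simp
    simp only [Ψ, LinearEquiv.trans_apply, LinearEquiv.prodCongr_apply,
      TensorProduct.lid_symm_apply, this, LinearEquiv.symm_apply_apply, map_add,
      TensorProduct.congr_tmul, LinearEquiv.refl_apply, he, hε]
    simp
  rw [← hfin]
  refine finrank_mul_defect_baseChange F⟮α⟯ φ hφ _ _ Ψ ?_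
  rintro ⟨x, y⟩
  rw [hΨ]
  exact baseChange_one_tmul_add F⟮α⟯ φ hφ hγ x y

theorem defect_baseChange_adjoin_zero {L : Type*} [Field L] [Algebra F L] (φ : QuadraticForm F V)
    (hφ : IsTotallySingular φ) :
    defect (baseChange F⟮(0 : L)⟯ φ hφ) (baseChange_isTotallySingular F⟮(0 : L)⟯ φ hφ) =
      defect φ hφ := by
  have hfin : finrank F F⟮(0 : L)⟯ = 1 := by
    rw [IntermediateField.adjoin_zero, IntermediateField.finrank_bot]
  have hfd : FiniteDimensional F F⟮(0 : L)⟯ := FiniteDimensional.of_finrank_pos (by omega)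
  let e : F ≃ₗ[F] F⟮(0 : L)⟯ := LinearEquiv.ofInjectiveOfFinrankEq
    (Algebra.linearMap F F⟮(0 : L)⟯) (algebraMap F F⟮(0 : L)⟯).injective
    ((finrank_self F).trans hfin.symm)
  have he : e 1 = 1 := (algebraMap F F⟮(0 : L)⟯).map_one
  let Ψ : V ≃ₗ[F] F⟮(0 : L)⟯ ⊗[F] V :=
    (TensorProduct.lid F V).symm ≪≫ₗ TensorProduct.congr e (LinearEquiv.refl F V)
  have hΨ : ∀ x, Ψ x = (1 : F⟮(0 : L)⟯) ⊗ₜ[F] x := by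
    intro x
    simp only [Ψ, LinearEquiv.trans_apply, TensorProduct.lid_symm_apply, TensorProduct.congr_tmul,
      he, LinearEquiv.refl_apply]
  have key := finrank_mul_defect_baseChange F⟮(0 : L)⟯ φ hφ φ hφ Ψ fun x => ?_
  · rwa [hfin, one_mul] at key
  rw [hΨ, baseChange_tmul, one_pow, one_mul]

/-- Weak Vishik equivalence only depends on the values, and says that the spans of the two spaces
of values by `1` and `a` have the same dimension for every `a`. -/
theorem WeaklyVishikEquivalent.sameSpans [FiniteDimensional F V] [FiniteDimensional F W]
    {φ : QuadraticForm F V} {hφ : IsTotallySingular φ} {ψ : QuadraticForm F W}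
    {hψ : IsTotallySingular ψ} (h : WeaklyVishikEquivalent φ hφ ψ hψ) :
    SameSpans (valueSpace φ hφ) (valueSpace ψ hψ) := by
  obtain ⟨hdim, hdef⟩ := h
  have hfin : finrank (frobenius F 2).fieldRange (valueSpace φ hφ) =
      finrank (frobenius F 2).fieldRange (valueSpace ψ hψ) := by
    have h0 := hdef 0 0 (by simp)
    rw [defect_baseChange_adjoin_zero, defect_baseChange_adjoin_zero] at h0
    have h1 := finrank_valueSpace_add_defect φ hφ
    have h2 := finrank_valueSpace_add_defect ψ hψ
    omega
  intro a
  obtain ⟨α, hα⟩ := IsAlgClosed.exists_pow_nat_eq (algebraMap F (AlgebraicClosure F) a) two_pos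
  by_cases hαF : ∃ x : F, algebraMap F (AlgebraicClosure F) x = α
  · -- for a square `a` the spans are the spaces of values themselves
    obtain ⟨x, rfl⟩ := hαF
    rw [← map_pow] at hα
    have hax : a = x ^ 2 := ((algebraMap F (AlgebraicClosure F)).injective hα).symm
    have hle : ∀ U : Submodule (frobenius F 2).fieldRange F, U ⊔ a • U = U := by
      intro U
      refine sup_of_le_left fun y hy => ?_
      obtain ⟨z, hz, rfl⟩ := (Submodule.mem_smul_pointwise_iff_exists _ _ _).1 hy
      rw [hax]
      exact mem_of_sq_mul_mem exists_fieldRange_eq_sq x hz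
    rw [hle, hle, hfin]
  · push Not at hαF
    have h0 := hdef a α hα
    have h1 := two_mul_defect_baseChange φ hφ hα hαF
    have h2 := two_mul_defect_baseChange ψ hψ hα hαF
    have h3 := finrank_valueSpace_add_defect _
      (isTotallySingular_prod hφ (isTotallySingular_smul hφ a))
    have h4 := finrank_valueSpace_add_defect _
      (isTotallySingular_prod hψ (isTotallySingular_smul hψ a))
    rw [valueSpace_prod hφ (isTotallySingular_smul hφ a), valueSpace_smul hφ, finrank_prod] at h3
    rw [valueSpace_prod hψ (isTotallySingular_smul hψ a), valueSpace_smul hψ, finrank_prod] at h4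
    omega

end QuadraticExtensions

/-! ### Similarity -/

section Neighbors

variable {F : Type*} [Field F] [CharP F 2] {S : Type*} [AddCommGroup S] [Module F S]
  [FiniteDimensional F S]

/-- Quasi-Pfister forms, quasi-Pfister neighbors of codimension one and minimal forms are
determined up to similarity by the spans of their values. -/
theorem exists_eq_smul_of_sameSpans {σ : QuadraticForm F S} (hσ : IsTotallySingular σ)
    (h : IsQuasiPfister σ ∨ IsQuasiPfisterNeighborOfCodim σ 1 ∨ IsMinimal σ)
    {U : Submodule (frobenius F 2).fieldRange F} [FiniteDimensional (frobenius F 2).fieldRange U]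
    (hU : SameSpans (valueSpace σ hσ) U) : ∃ e : F, e ≠ 0 ∧ U = e • valueSpace σ hσ := by
  rcases h with h | h | h
  · obtain ⟨M, hM⟩ := h.exists_valueSpace_eq hσ
    have : FiniteDimensional (frobenius F 2).fieldRange M := by
      have h1 := finiteDimensional_valueSpace σ hσ
      rw [hM] at h1
      exact h1
    refine hU.exists_eq_smul_of_le_field M hM.le ?_
    rw [hM]
    exact Nat.le_succ _
  · obtain ⟨n, a, c, hc, hsub, -, hcodim⟩ := h
    obtain ⟨M, hM⟩ := exists_valueSpace_pfister_eq a
    have : FiniteDimensional (frobenius F 2).fieldRange M := by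
      have h1 := finiteDimensional_valueSpace _ (isTotallySingular_pfister a)
      rw [hM] at h1
      exact h1
    have hcσ := isTotallySingular_smul hσ c
    have hle : c • valueSpace σ hσ ≤ Subalgebra.toSubmodule M.toSubalgebra := by
      obtain ⟨f, -, hf⟩ := hsub
      rw [← hM, ← valueSpace_smul hσ]
      exact valueSpace_le_of_isometry hcσ _ f hf
    have hfin : finrank (frobenius F 2).fieldRange M ≤
        finrank (frobenius F 2).fieldRange (c • valueSpace σ hσ : Submodule _ F) + 1 := by
      have h1 := finrank_valueSpace_add_defect _ hcσ
      have h2 := finrank_valueSpace_add_defect _ (isTotallySingular_pfister a)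
      have h3 := defect_le_of_isSubform hcσ (isTotallySingular_pfister a) hsub
      have h4 : finrank F (Finset (Fin n) → F) = 2 ^ n := by simp
      rw [hM] at h2
      change finrank (frobenius F 2).fieldRange M + _ = _ at h2
      rw [valueSpace_smul hσ] at h1
      omega
    have hcU := (sameSpans_smul (valueSpace σ hσ) hc).trans hU
    obtain ⟨e, he, heU⟩ := hcU.exists_eq_smul_of_le_field M hle hfin
    exact ⟨e * c, mul_ne_zero he hc, by rw [heU, smul_smul]⟩
  · obtain ⟨haniso, hpos, hdeg⟩ := h
    have hfin : finrank (frobenius F 2).fieldRange (valueSpace σ hσ) = finrank F S := by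
      have h1 := finrank_valueSpace_add_defect σ hσ
      rwa [defect_eq_zero_of_anisotropic hσ haniso, add_zero] at h1
    refine hU.exists_eq_smul_of_degree exists_fieldRange_eq_sq (hfin ▸ hpos) ?_
    have hset : {z : F | ∃ x ∈ valueSpace σ hσ, ∃ y ∈ valueSpace σ hσ, x ≠ 0 ∧ y ≠ 0 ∧ z = x / y} =
        {z : F | ∃ x y : S, σ x ≠ 0 ∧ σ y ≠ 0 ∧ z = σ x / σ y} := by
      ext z
      constructor
      · rintro ⟨_, ⟨x, rfl⟩, _, ⟨y, rfl⟩, hx, hy, rfl⟩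
        exact ⟨x, y, hx, hy, rfl⟩
      · rintro ⟨x, y, hx, hy, rfl⟩
        exact ⟨_, ⟨x, rfl⟩, _, ⟨y, rfl⟩, hx, hy, rfl⟩
    rw [hfin, ← hdeg, normDegree, normField, hset]

end Neighbors

end TSForm

open TSForm in
theorem mainTheorem3 {F : Type*} [Field F] [CharP F 2]
    {V W P S : Type*}
    [AddCommGroup V] [Module F V] [FiniteDimensional F V]
    [AddCommGroup W] [Module F W] [FiniteDimensional F W]
    [AddCommGroup P] [Module F P] [FiniteDimensional F P]
    [AddCommGroup S] [Module F S] [FiniteDimensional F S]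
    (φ : QuadraticForm F V) (hφ : IsTotallySingular φ)
    (ψ : QuadraticForm F W) (hψ : IsTotallySingular ψ)
    (hv : WeaklyVishikEquivalent φ hφ ψ hψ)
    (π : QuadraticForm F P) (b : F) (σ : QuadraticForm F S)
    (hspn : IsSpecialQuasiPfisterNeighbor φ π b σ)
    (hπψ : ∃ c : F, c ≠ 0 ∧ IsSubform (c • π) ψ)
    (hσ : IsQuasiPfister σ ∨ IsQuasiPfisterNeighborOfCodim σ 1 ∨ IsMinimal σ) :
    IsSimilar φ ψ := by
  obtain ⟨hπ, hb, ⟨f, -, hf⟩, c₀, hc₀, hφeq⟩ := hspn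
  obtain ⟨c, hc, g, -, hg⟩ := hπψ
  have hπs := hπ.isTotallySingular
  have hσs := isTotallySingular_of_isometry hπs f hf
  have hbσ := isTotallySingular_smul hσs b
  obtain ⟨L, hL⟩ := hπ.exists_valueSpace_eq hπs
  have hLfd : FiniteDimensional (frobenius F 2).fieldRange L := by
    have h1 := finiteDimensional_valueSpace π hπs
    rw [hL] at h1
    exact h1
  have hss := hv.sameSpans
  set M := Subalgebra.toSubmodule L.toSubalgebra with hM
  have hφU : valueSpace φ hφ = c₀ • (M ⊔ b • valueSpace σ hσs) := by
    rw [valueSpace_eq_of_equivalent hφ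
      (isTotallySingular_smul (isTotallySingular_prod hπs hbσ) c₀) hφeq,
      valueSpace_smul (isTotallySingular_prod hπs hbσ), valueSpace_prod hπs hbσ,
      valueSpace_smul hσs, hL]
  have hσM : valueSpace σ hσs ≤ M := hL ▸ valueSpace_le_of_isometry hσs hπs f hf
  have hci := inv_ne_zero hc
  -- after scaling, `M` is contained in the values of both forms
  have hMψ : M ≤ c⁻¹ • valueSpace ψ hψ := by
    have h1 := smul_le_smul_submodule c⁻¹
      (valueSpace_le_of_isometry (isTotallySingular_smul hπs c) hψ g hg)
    rwa [valueSpace_smul hπs, smul_smul, inv_mul_cancel₀ hc, one_smul, hL] at h1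
  have hss' : SameSpans (M ⊔ b • valueSpace σ hσs) (c⁻¹ • valueSpace ψ hψ) := by
    rw [hφU] at hss
    exact ((sameSpans_smul _ hc₀).symm.trans hss).trans (sameSpans_smul _ hci).symm
  suffices ∃ e : F, e ≠ 0 ∧ c⁻¹ • valueSpace ψ hψ = e • (M ⊔ b • valueSpace σ hσs) by
    obtain ⟨e, he, heq⟩ := this
    refine isSimilar_of_valueSpace_eq hφ hψ hv.1
      (mul_ne_zero hc₀ (mul_ne_zero (inv_ne_zero he) hci)) ?_
    rw [mul_smul, mul_smul, heq, smul_smul e⁻¹ e, inv_mul_cancel₀ he, one_smul, hφU]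
  by_cases hbL : b ∈ L
  · -- here `φ` has the same values as `π`
    have h1 : M ⊔ b • valueSpace σ hσs = M :=
      sup_of_le_left ((smul_le_smul_submodule b hσM).trans (smul_le_of_mem hbL))
    refine ⟨1, one_ne_zero, ?_⟩
    rw [h1] at hss' ⊢
    rw [one_smul]
    exact (Submodule.eq_of_le_of_finrank_eq hMψ hss'.finrank_eq).symm
  · obtain ⟨S', hS'M, hS', hSS'⟩ := exists_eq_sup_smul exists_fieldRange_eq_sq L hbL hσM hMψ hss'
    have hMfd : FiniteDimensional (frobenius F 2).fieldRange M := hLfd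
    have hS'fd := Submodule.finiteDimensional_of_le hS'M
    obtain ⟨e, he, rfl⟩ := exists_eq_smul_of_sameSpans hσs hσ hSS'
    -- if `S` is nonzero, the factor `e` lies in `L`, so that multiplication by it preserves `M`
    by_cases hbot : valueSpace σ hσs = ⊥
    · refine ⟨1, one_ne_zero, ?_⟩
      rw [hS', hbot, one_smul]
      congr 2
      exact Submodule.map_bot _
    · obtain ⟨x, hx, hx0⟩ := Submodule.exists_mem_ne_zero_of_ne_bot hbot
      have heL : e ∈ L := by
        have h1 : e * x ∈ L := hS'M (mul_mem_smul hx)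
        have := L.div_mem h1 (hσM hx)
        rwa [mul_div_cancel_right₀ _ hx0] at this
      refine ⟨e, he, ?_⟩
      have heM : e • M = M :=
        Submodule.eq_of_le_of_finrank_eq (smul_le_of_mem heL) (finrank_smul_submodule M he)
      rw [hS', Submodule.smul_sup', heM, smul_comm b e]
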